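/- Let $\mathcal{G}$ be a Grothendieck category (an abelian category with small Hom-sets, all small direct sums, exact direct limits and a generator), and let $\{U_i\}_{i\in I}$ be a generating set in $\mathcal{G}$, that is, a family of objects indexed by a small set $I$ such that for every nonzero morphism $f\colon X\to Y$ there are $i\in I$ and $g\colon U_i\to X$ with $fg\neq 0$. Let $R:=\bigoplus_{i,j\in I}\operatorname{Hom}_{\mathcal{G}}(U_i,U_j)$, with the multiplication in which the product of $f\colon U_k\to U_l$ and $r\colon U_i\to U_j$ is the composite $f\circ r$ if $j=k$ and $0$ otherwise. This is a ring with enough idempotents (in general without identity): the elements $\mathrm{id}_{U_i}$ form a complete set of orthogonal idempotents. Let $\operatorname{MOD}R$ be the abelian category of right $R$-modules $M$ with $MR=M$, and let $G:=\bigoplus_{i\in I}\operatorname{Hom}_{\mathcal{G}}(U_i,-)\colon\mathcal{G}\to\operatorname{MOD}R$, where $R$ acts by composition. Then $G$ has a left adjoint $F$, and the full subcategory $\mathcal{X}\subset\operatorname{MOD}R$ of all $M$ with $F(M)=0$ is a localizing subcategory, that is, a Serre subcategory (closed under subobjects, quotient objects and extensions) such that the canonical functor $\operatorname{MOD}R\to(\operatorname{MOD}R)/\mathcal{X}$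 to the quotient category has a right adjoint. Moreover, the following conditions are equivalent: 1. $\mathcal{G}$ satisfies Ab6 and Ab4*. Here Ab4* means that direct products of short exact sequences are exact, and Ab6 means that for every object $M\in\mathcal{G}$ and every family $\{\{L_i^j\}_{i\in I_j}\}_{j\in J}$ of (nonempty) directed sets of subobjects of $M$, $$\bigcap_{j\in J}\Bigl(\sum_{i\in I_j}L_i^j\Bigr)=\sum_{(i_j)_{j}\in\prod_{j\in J}I_j}\Bigl(\bigcap_{j\in J}L_{i_j}^j\Bigr).$$ 2. $\mathcal{X}$ is closed under direct products in $\operatorname{MOD}R$. 3. $\mathcal{X}$ is a bilocalizing subcategory of $\operatorname{MOD}R$, that is, it is localizing and the canonical functor $\operatorname{MOD}R\to(\operatorname{MOD}R)/\mathcal{X}$ also has a left adjoint. -/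

import Mathlib

open CategoryTheory CategoryTheory.Limits
open scoped DirectSum

universe u v w

namespace Roos

/-! ### Rings with enough idempotents and their unitary right modules -/

section Ring

variable (R : Type w) [NonUnitalRing R]

/-- The additive subgroup `a R b` of `R`. -/
def corner {R : Type w} [NonUnitalRing R] (a b : R) : AddSubgroup R :=
  ((AddMonoidHom.mulLeft a).comp (AddMonoidHom.mulRight b)).range

open scoped Classical in
/-- `e` is a complete family of orthogonal idempotents: the `e i` are pairwise orthogonal
idempotents, and `R` is the (internal) direct sum of the subgroups `e i * R * e j`. -/
structure IsCompleteOrthogonal {R : Type w} [NonUnitalRing R] {ι : Type w} (e : ι → R) :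
    Prop where
  idem : ∀ i, e i * e i = e i
  ortho : ∀ i j, i ≠ j → e i * e j = 0
  complete : DirectSum.IsInternal fun p : ι × ι => corner (e p.1) (e p.2)

/-- `R` has enough idempotents. -/
class HasEnoughIdempotents : Prop where
  exists_complete : ∃ (ι : Type w) (e : ι → R), IsCompleteOrthogonal e

/-- The Dorroh overring of `R`: the additive group `ℤ × R` with the multiplication
`(m, r) * (n, s) = (m * n, m • s + n • r + r * s)` and the unit `(1, 0)`. -/
def Dorroh : Type w := Unitization ℤ R

instance : Ring (Dorroh R) := inferInstanceAs (Ring (Unitization ℤ R))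

variable {R} in
/-- The inclusion `r ↦ (0, r)` of `R` into its Dorroh overring. -/
def Dorroh.inr (r : R) : Dorroh R := (Unitization.inr r : Unitization ℤ R)

variable {R} in
/-- The first component of an element of the Dorroh overring. -/
def Dorroh.fst (a : Dorroh R) : ℤ := (Unitization.toProd (R := ℤ) (A := R) a).1

variable {R} in
/-- The second component of an element of the Dorroh overring. -/
def Dorroh.snd (a : Dorroh R) : R := (Unitization.toProd (R := ℤ) (A := R) a).2

lemma Dorroh.inr_add (r s : R) : inr (r + s) = inr r + inr s := Unitization.inr_add ℤ r s

lemma Dorroh.inr_mul (r s : R) : inr (r * s) = inr r * inr s := Unitization.inr_mul ℤ r s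

/-- The category of all right modules over the (not necessarily unital) ring `R`: these are the
unital right modules over the Dorroh overring of `R`, i.e. the left modules over its opposite
ring. -/
abbrev RightMod : Type (w + 1) := ModuleCat.{w} (Dorroh R)ᵐᵒᵖ

variable {R}

/-- The right action `m · r` of `r : R` on a right `R`-module, as a biadditive map. -/
def ract (M : RightMod R) : R →+ M →+ M :=
  AddMonoidHom.mk' (fun r => AddMonoidHom.mk' (fun m : M => MulOpposite.op (Dorroh.inr r) • m)
      (fun _ _ => smul_add _ _ _))
    (fun r s => by
      ext m
      simp only [AddMonoidHom.mk'_apply, AddMonoidHom.add_apply, Dorroh.inr_add,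
        MulOpposite.op_add, add_smul])

lemma ract_apply (M : RightMod R) (r : R) (m : M) :
    ract M r m = MulOpposite.op (Dorroh.inr r) • m := rfl

lemma ract_mul (M : RightMod R) (r s : R) (m : M) :
    ract M (r * s) m = ract M s (ract M r m) := by
  simp only [ract_apply, Dorroh.inr_mul, MulOpposite.op_mul, mul_smul]

lemma map_ract {M N : RightMod R} (f : M ⟶ N) (r : R) (m : M) :
    f (ract M r m) = ract N r (f m) := by
  simp [ract_apply]

/-- The additive subgroup `M R` of `M`, consisting of the finite sums of elements `m · r`. -/
def mulRing (M : RightMod R) : AddSubgroup M :=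
  AddSubgroup.closure {x | ∃ (r : R) (m : M), x = ract M r m}

variable (R) in
/-- The right `R`-modules `M` with `M R = M`. -/
def isUnitary : ObjectProperty (RightMod R) := fun M => mulRing M = ⊤

variable (R) in
/-- The full subcategory of the category of right `R`-modules given by the `M` with `M R = M`. -/
abbrev UnitaryMod : Type (w + 1) := (isUnitary R).FullSubcategory

lemma map_mem_mulRing {M N : RightMod R} (f : M ⟶ N) {m : M} (hm : m ∈ mulRing M) :
    f m ∈ mulRing N := by
  induction hm using AddSubgroup.closure_induction with
  | mem x hx =>
    obtain ⟨r, m, rfl⟩ := hx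
    rw [map_ract]
    exact AddSubgroup.subset_closure ⟨r, _, rfl⟩
  | zero => rw [map_zero]; exact zero_mem _
  | add x y _ _ hx hy => rw [map_add]; exact add_mem hx hy
  | neg x _ hx => rw [map_neg]; exact neg_mem hx

/-- In a ring with enough idempotents, every element of a unitary right module is fixed by some
element of the ring. -/
lemma exists_ract_eq [HasEnoughIdempotents R] (M : RightMod R) {m : M} (hm : m ∈ mulRing M) :
    ∃ r : R, ract M r m = m := by
  classical
  obtain ⟨ι, e, he⟩ := HasEnoughIdempotents.exists_complete (R := R)
  have mul_e : ∀ i j, e i * e j = if i = j then e i else 0 := by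
    intro i j
    split_ifs with h
    · subst h; exact he.idem i
    · exact he.ortho i j h
  have key : ∀ r : R, ∃ s : Finset ι, ∀ t, s ⊆ t → r * ∑ i ∈ t, e i = r := by
    intro r
    obtain ⟨x, rfl⟩ := he.complete.2 r
    induction x using DirectSum.induction_on with
    | zero => exact ⟨∅, fun t _ => by simp⟩
    | of p x =>
      obtain ⟨_, y, rfl⟩ := x
      refine ⟨{p.2}, fun t ht => ?_⟩
      have hp : p.2 ∈ t := ht (by simp)
      simp [mul_assoc, Finset.mul_sum, mul_e, hp]
    | add x y hx hy =>
      obtain ⟨s, hs⟩ := hx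
      obtain ⟨s', hs'⟩ := hy
      refine ⟨s ∪ s', fun t ht => ?_⟩
      rw [map_add, add_mul, hs t (Finset.union_subset_left ht),
        hs' t (Finset.union_subset_right ht)]
  suffices h : ∃ s : Finset ι, ∀ t, s ⊆ t → ract M (∑ i ∈ t, e i) m = m by
    obtain ⟨s, hs⟩ := h
    exact ⟨_, hs s subset_rfl⟩
  induction hm using AddSubgroup.closure_induction with
  | mem x hx =>
    obtain ⟨r, m, rfl⟩ := hx
    obtain ⟨s, hs⟩ := key r
    exact ⟨s, fun t ht => by rw [← ract_mul, hs t ht]⟩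
  | zero => exact ⟨∅, fun t _ => map_zero _⟩
  | add x y _ _ hx hy =>
    obtain ⟨s, hs⟩ := hx
    obtain ⟨s', hs'⟩ := hy
    exact ⟨s ∪ s', fun t ht => by
      rw [map_add, hs t (Finset.union_subset_left ht), hs' t (Finset.union_subset_right ht)]⟩
  | neg x _ hx =>
    obtain ⟨s, hs⟩ := hx
    exact ⟨s, fun t ht => by rw [map_neg, hs t ht]⟩

instance : (isUnitary R).ContainsZero where
  exists_zero := by
    refine ⟨ModuleCat.of _ PUnit, ModuleCat.isZero_of_subsingleton _, ?_⟩
    exact (AddSubgroup.eq_top_iff' _).2 fun x => by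
      rw [Subsingleton.elim x 0]; exact zero_mem _

instance : (isUnitary R).IsClosedUnderQuotients where
  prop_of_epi {M N} f _ hM := by
    refine (AddSubgroup.eq_top_iff' _).2 fun y => ?_
    obtain ⟨x, rfl⟩ := (ModuleCat.epi_iff_surjective f).1 inferInstance y
    have hx : x ∈ mulRing M := by rw [show mulRing M = ⊤ from hM]; trivial
    exact map_mem_mulRing f hx

instance [HasEnoughIdempotents R] : (isUnitary R).IsClosedUnderSubobjects where
  prop_of_mono {M N} f _ hN := by
    refine (AddSubgroup.eq_top_iff' _).2 fun x => ?_
    have hx : f x ∈ mulRing N := by rw [show mulRing N = ⊤ from hN]; trivial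
    obtain ⟨r, hr⟩ := exists_ract_eq N hx
    rw [← map_ract] at hr
    have := (ModuleCat.mono_iff_injective f).1 inferInstance hr
    exact AddSubgroup.subset_closure ⟨r, x, this.symm⟩

instance : (isUnitary R).IsClosedUnderBinaryProducts where
  limitsOfShape_le := by
    rintro M ⟨p⟩
    let A := p.diag.obj ⟨WalkingPair.left⟩
    let B := p.diag.obj ⟨WalkingPair.right⟩
    have e : M ≅ A ⊞ B :=
      p.isLimit.conePointUniqueUpToIso
        ((IsLimit.postcomposeHomEquiv (diagramIsoPair p.diag).symm _).symm
          (BinaryBiproduct.isLimit A B))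
    have hA : mulRing A = ⊤ := p.prop_diag_obj ⟨WalkingPair.left⟩
    have hB : mulRing B = ⊤ := p.prop_diag_obj ⟨WalkingPair.right⟩
    refine (AddSubgroup.eq_top_iff' _).2 fun x => ?_
    have h : x = (biprod.inl ≫ e.inv) ((e.hom ≫ biprod.fst) x) +
        (biprod.inr ≫ e.inv) ((e.hom ≫ biprod.snd) x) := by
      have : 𝟙 M = (e.hom ≫ biprod.fst) ≫ (biprod.inl ≫ e.inv) +
          (e.hom ≫ biprod.snd) ≫ (biprod.inr ≫ e.inv) := by
        have h : (e.hom ≫ biprod.fst) ≫ (biprod.inl ≫ e.inv) +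
            (e.hom ≫ biprod.snd) ≫ (biprod.inr ≫ e.inv) =
            e.hom ≫ (biprod.fst ≫ biprod.inl + biprod.snd ≫ biprod.inr) ≫ e.inv := by
          simp only [Category.assoc, Preadditive.add_comp, Preadditive.comp_add]
        rw [h, biprod.total, Category.id_comp, e.hom_inv_id]
      exact congrArg (fun k : M ⟶ M => k x) this
    rw [h]
    exact add_mem (map_mem_mulRing _ (by rw [hA]; trivial)) (map_mem_mulRing _ (by rw [hB]; trivial))

instance [HasEnoughIdempotents R] : (isUnitary R).IsClosedUnderFiniteProducts :=
  ObjectProperty.IsClosedUnderFiniteProducts.mk'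

/-- An abelian group with a biadditive associative right action of `R` is a right `R`-module:
`(n, r)` acts by `m ↦ n • m + m · r`. -/
@[reducible]
def moduleOfAction {M : Type*} [AddCommGroup M] (act : R →+ M →+ M)
    (h : ∀ r s m, act (r * s) m = act s (act r m)) : Module (Dorroh R)ᵐᵒᵖ M where
  smul a m := Dorroh.fst a.unop • m +
    act (Dorroh.snd a.unop) m
  one_smul m := by
    change (1 : ℤ) • m + act 0 m = m
    simp
  zero_smul m := by
    change (0 : ℤ) • m + act 0 m = 0
    simp
  smul_zero a := by
    change _ • (0 : M) + act _ 0 = 0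
    simp
  smul_add a m n := by
    change _ • (m + n) + act _ (m + n) = (_ • m + act _ m) + (_ • n + act _ n)
    rw [smul_add, map_add]
    abel
  add_smul a b m := by
    change (a.unop.fst + b.unop.fst) • m + act (a.unop.snd + b.unop.snd) m =
      (a.unop.fst • m + act a.unop.snd m) + (b.unop.fst • m + act b.unop.snd m)
    rw [add_smul, map_add, AddMonoidHom.add_apply]
    abel
  mul_smul a b m := by
    obtain ⟨⟨n, r⟩⟩ := a
    obtain ⟨⟨k, s⟩⟩ := b
    change (k * n : ℤ) • m + act (k • r + n • s + s * r) m =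
      n • (k • m + act s m) + act r (k • m + act s m)
    simp only [map_add, AddMonoidHom.add_apply, h, map_zsmul, AddMonoidHom.coe_smul,
      Pi.smul_apply, smul_add, mul_comm k n, mul_smul]
    abel

end Ring

/-! ### The ring of a family of objects and the functor to its unitary modules -/

section Family

variable {C : Type u} [Category.{v} C] [Preadditive C] {ι : Type v} (U : ι → C)

/-- The additive group `⨁ i, Hom (U i, X)`. -/
def HomSum (X : C) : Type v := ⨁ i, (U i ⟶ X)

noncomputable instance (X : C) : AddCommGroup (HomSum U X) :=
  inferInstanceAs (AddCommGroup (⨁ i, (U i ⟶ X)))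

/-- The additive group `⨁ i j, Hom (U i, U j)`. -/
def FamilyRing : Type v := ⨁ p : ι × ι, (U p.1 ⟶ U p.2)

noncomputable instance : AddCommGroup (FamilyRing U) :=
  inferInstanceAs (AddCommGroup (⨁ p : ι × ι, (U p.1 ⟶ U p.2)))

open scoped Classical in
/-- The inclusion of `Hom (U i, X)` into `⨁ i, Hom (U i, X)`. -/
noncomputable def HomSum.of {X : C} (i : ι) : (U i ⟶ X) →+ HomSum U X :=
  DirectSum.of (fun i => (U i ⟶ X)) i

open scoped Classical in
/-- The inclusion of `Hom (U i, U j)` into `⨁ i j, Hom (U i, U j)`. -/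
noncomputable def FamilyRing.of (i j : ι) : (U i ⟶ U j) →+ FamilyRing U :=
  DirectSum.of (fun p : ι × ι => (U p.1 ⟶ U p.2)) (i, j)

open scoped Classical in
/-- An additive map out of `⨁ i, Hom (U i, X)` given by its components. -/
noncomputable def HomSum.lift {X : C} {A : Type*} [AddCommGroup A]
    (φ : ∀ i, (U i ⟶ X) →+ A) : HomSum U X →+ A :=
  DirectSum.toAddMonoid φ

open scoped Classical in
/-- An additive map out of `⨁ i j, Hom (U i, U j)` given by its components. -/
noncomputable def FamilyRing.lift {A : Type*} [AddCommGroup A]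
    (φ : ∀ i j, (U i ⟶ U j) →+ A) : FamilyRing U →+ A :=
  DirectSum.toAddMonoid (β := fun p : ι × ι => (U p.1 ⟶ U p.2)) fun p => φ p.1 p.2

variable {U}

@[simp]
lemma HomSum.lift_of {X : C} {A : Type*} [AddCommGroup A]
    (φ : ∀ i, (U i ⟶ X) →+ A) (i : ι) (f : U i ⟶ X) :
    HomSum.lift U φ (HomSum.of U i f) = φ i f := by
  classical
  exact DirectSum.toAddMonoid_of _ _ _

@[simp]
lemma FamilyRing.lift_of {A : Type*} [AddCommGroup A]
    (φ : ∀ i j, (U i ⟶ U j) →+ A) (i j : ι) (f : U i ⟶ U j) :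
    FamilyRing.lift U φ (FamilyRing.of U i j f) = φ i j f := by
  classical
  exact DirectSum.toAddMonoid_of (β := fun p : ι × ι => (U p.1 ⟶ U p.2)) _ (i, j) _

lemma HomSum.induction {X : C} {motive : HomSum U X → Prop} (x : HomSum U X) (zero : motive 0)
    (of : ∀ i f, motive (HomSum.of U i f))
    (add : ∀ x y, motive x → motive y → motive (x + y)) : motive x := by
  classical
  exact DirectSum.induction_on (β := fun i => (U i ⟶ X)) x zero of add

lemma FamilyRing.induction {motive : FamilyRing U → Prop} (x : FamilyRing U) (zero : motive 0)
    (of : ∀ i j f, motive (FamilyRing.of U i j f))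
    (add : ∀ x y, motive x → motive y → motive (x + y)) : motive x := by
  classical
  exact DirectSum.induction_on (β := fun p : ι × ι => (U p.1 ⟶ U p.2)) x zero
    (fun p f => of p.1 p.2 f) add

variable (U)

open scoped Classical in
/-- The right action of `⨁ i j, Hom (U i, U j)` on `⨁ i, Hom (U i, X)` by composition:
`f : U k ⟶ X` times `r : U i ⟶ U j` is the composite `f ∘ r` if `j = k`, and `0` otherwise. -/
noncomputable def act (X : C) : FamilyRing U →+ HomSum U X →+ HomSum U X :=
  FamilyRing.lift U fun i j => AddMonoidHom.mk' (fun r => HomSum.lift U fun k =>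
      if h : j = k then (HomSum.of U i).comp (Preadditive.compHom (r ≫ eqToHom (by rw [h]))) else 0)
    (fun r s => by
      ext x
      induction x using HomSum.induction with
      | zero => simp
      | of k f =>
        by_cases h : j = k
        · subst h
          simp [Preadditive.compHom, Preadditive.leftComp]
        · simp [h]
      | add x y hx hy => rw [map_add, map_add, hx, hy])

open scoped Classical in
/-- The multiplication of `⨁ i j, Hom (U i, U j)`: the product of `f : U k ⟶ U l` and
`r : U i ⟶ U j` is the composite `f ∘ r` if `j = k`, and `0` otherwise. -/
noncomputable def FamilyRing.mulHom : FamilyRing U →+ FamilyRing U →+ FamilyRing U :=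
  FamilyRing.lift U fun k l => AddMonoidHom.mk' (fun f => FamilyRing.lift U fun i j =>
      if h : j = k then (FamilyRing.of U i l).comp
        ((Preadditive.compHom (P := U i) (Q := U j)).flip (eqToHom (by rw [h]) ≫ f)) else 0)
    (fun f g => by
      ext x
      induction x using FamilyRing.induction with
      | zero => simp
      | of i j r =>
        by_cases h : j = k
        · subst h
          simp [Preadditive.compHom, Preadditive.leftComp]
        · simp [h]
      | add x y hx hy => rw [map_add, map_add, hx, hy])

variable {U}

lemma act_of_of {X : C} {i k : ι} (r : U i ⟶ U k) (f : U k ⟶ X) :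
    act U X (FamilyRing.of U i k r) (HomSum.of U k f) = HomSum.of U i (r ≫ f) := by
  simp [act, Preadditive.compHom, Preadditive.leftComp]

lemma act_of_of_ne {X : C} {i j k : ι} (h : j ≠ k) (r : U i ⟶ U j) (f : U k ⟶ X) :
    act U X (FamilyRing.of U i j r) (HomSum.of U k f) = 0 := by
  simp [act, h]

lemma FamilyRing.mulHom_of_of {i k l : ι} (f : U k ⟶ U l) (r : U i ⟶ U k) :
    FamilyRing.mulHom U (FamilyRing.of U k l f) (FamilyRing.of U i k r) =
      FamilyRing.of U i l (r ≫ f) := by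
  simp [FamilyRing.mulHom, Preadditive.compHom, Preadditive.leftComp]

lemma FamilyRing.mulHom_of_of_ne {i j k l : ι} (h : j ≠ k) (f : U k ⟶ U l) (r : U i ⟶ U j) :
    FamilyRing.mulHom U (FamilyRing.of U k l f) (FamilyRing.of U i j r) = 0 := by
  simp [FamilyRing.mulHom, h]

lemma FamilyRing.mulHom_assoc (x y z : FamilyRing U) :
    mulHom U (mulHom U x y) z = mulHom U x (mulHom U y z) := by
  induction x using FamilyRing.induction with
  | zero => simp
  | add x x' hx hx' => simp only [map_add, AddMonoidHom.add_apply, hx, hx']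
  | of k l f =>
    induction y using FamilyRing.induction with
    | zero => simp
    | add y y' hy hy' => simp only [map_add, AddMonoidHom.add_apply, hy, hy']
    | of i j r =>
      induction z using FamilyRing.induction with
      | zero => simp
      | add z z' hz hz' => simp only [map_add, hz, hz']
      | of a b s =>
        by_cases h : j = k
        · subst h
          by_cases h' : b = i
          · subst h'
            simp only [mulHom_of_of, Category.assoc]
          · simp only [mulHom_of_of, mulHom_of_of_ne h', map_zero]
        · by_cases h' : b = i
          · subst h'
            simp only [mulHom_of_of, mulHom_of_of_ne h, map_zero, AddMonoidHom.zero_apply]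
          · simp only [mulHom_of_of_ne h, mulHom_of_of_ne h', map_zero, AddMonoidHom.zero_apply]

noncomputable instance : NonUnitalRing (FamilyRing U) where
  mul x y := FamilyRing.mulHom U x y
  left_distrib x y z := map_add (FamilyRing.mulHom U x) y z
  right_distrib x y z := by
    change FamilyRing.mulHom U (x + y) z = FamilyRing.mulHom U x z + FamilyRing.mulHom U y z
    rw [map_add, AddMonoidHom.add_apply]
  zero_mul x := by
    change FamilyRing.mulHom U 0 x = 0
    rw [map_zero, AddMonoidHom.zero_apply]
  mul_zero x := map_zero (FamilyRing.mulHom U x)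
  mul_assoc := FamilyRing.mulHom_assoc

lemma FamilyRing.of_mul_of {i k l : ι} (f : U k ⟶ U l) (r : U i ⟶ U k) :
    FamilyRing.of U k l f * FamilyRing.of U i k r = FamilyRing.of U i l (r ≫ f) :=
  mulHom_of_of f r

lemma FamilyRing.of_mul_of_ne {i j k l : ι} (h : j ≠ k) (f : U k ⟶ U l) (r : U i ⟶ U j) :
    FamilyRing.of U k l f * FamilyRing.of U i j r = 0 :=
  mulHom_of_of_ne h f r

lemma act_mul {X : C} (x y : FamilyRing U) (m : HomSum U X) :
    act U X (x * y) m = act U X y (act U X x m) := by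
  induction m using HomSum.induction with
  | zero => simp
  | add m m' hm hm' => simp only [map_add, hm, hm']
  | of c g =>
    induction x using FamilyRing.induction with
    | zero => simp
    | add x x' hx hx' => simp only [map_add, AddMonoidHom.add_apply, add_mul, hx, hx']
    | of k l f =>
      induction y using FamilyRing.induction with
      | zero => simp
      | add y y' hy hy' => simp only [map_add, AddMonoidHom.add_apply, mul_add, hy, hy']
      | of i j r =>
        by_cases h : j = k
        · subst h
          by_cases h' : l = c
          · subst h'
            simp only [FamilyRing.of_mul_of, act_of_of, Category.assoc]
          · simp only [FamilyRing.of_mul_of, act_of_of_ne h', map_zero]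
        · by_cases h' : l = c
          · subst h'
            simp only [FamilyRing.of_mul_of_ne h, act_of_of, act_of_of_ne h, map_zero,
              AddMonoidHom.zero_apply]
          · simp only [FamilyRing.of_mul_of_ne h, act_of_of_ne h', map_zero,
              AddMonoidHom.zero_apply]

variable (U) in
/-- The idempotents `𝟙 (U i)` form a complete orthogonal family. -/
lemma isCompleteOrthogonal_id :
    IsCompleteOrthogonal fun i => FamilyRing.of U i i (𝟙 (U i)) := by
  classical
  have mul_id : ∀ i j : ι, FamilyRing.of U i i (𝟙 (U i)) * FamilyRing.of U j j (𝟙 (U j)) =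
      if i = j then FamilyRing.of U i i (𝟙 (U i)) else 0 := by
    intro i j
    split_ifs with h
    · subst h
      rw [FamilyRing.of_mul_of, Category.id_comp]
    · exact FamilyRing.of_mul_of_ne (Ne.symm h) _ _
  refine ⟨fun i => by rw [FamilyRing.of_mul_of, Category.id_comp],
    fun i j h => FamilyRing.of_mul_of_ne (Ne.symm h) _ _, ?_, ?_⟩
  · refine (injective_iff_map_eq_zero _).2 fun x hx => ?_
    have key : ∀ p : ι × ι, FamilyRing.of U p.1 p.1 (𝟙 (U p.1)) *
        (DirectSum.coeAddMonoidHom (fun p : ι × ι => corner (FamilyRing.of U p.1 p.1 (𝟙 (U p.1)))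
          (FamilyRing.of U p.2 p.2 (𝟙 (U p.2)))) x *
          FamilyRing.of U p.2 p.2 (𝟙 (U p.2))) = (x p : FamilyRing U) := by
      clear hx
      intro p
      induction x using DirectSum.induction_on with
      | zero => simp
      | add x y hx hy =>
        rw [map_add, add_mul, mul_add, hx, hy, DirectSum.add_apply, AddSubgroup.coe_add]
      | of q x =>
        obtain ⟨_, y, rfl⟩ := x
        rw [DirectSum.coeAddMonoidHom_of, DirectSum.coe_of_apply]
        change _ * (FamilyRing.of U q.1 q.1 (𝟙 (U q.1)) *
          (y * FamilyRing.of U q.2 q.2 (𝟙 (U q.2))) * _) = _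
        rw [mul_assoc, mul_assoc, ← mul_assoc, mul_id, mul_id]
        by_cases h : q = p
        · subst h
          simp
        · rw [if_neg h]
          by_cases h1 : p.1 = q.1
          · have h2 : q.2 ≠ p.2 := fun h2 => h (Prod.ext h1.symm h2)
            simp [h2]
          · simp [h1]
    ext p
    rw [← key p, hx]
    simp
  · intro x
    rw [← AddMonoidHom.mem_range]
    induction x using FamilyRing.induction with
    | zero => exact zero_mem _
    | add x y hx hy => exact add_mem hx hy
    | of i j f =>
      have hf : FamilyRing.of U i j f ∈ corner (FamilyRing.of U j j (𝟙 (U j)))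
          (FamilyRing.of U i i (𝟙 (U i))) := by
        refine ⟨FamilyRing.of U i j f, ?_⟩
        change FamilyRing.of U j j (𝟙 (U j)) *
          (FamilyRing.of U i j f * FamilyRing.of U i i (𝟙 (U i))) = _
        rw [FamilyRing.of_mul_of, FamilyRing.of_mul_of, Category.id_comp, Category.comp_id]
      exact ⟨DirectSum.of (fun p : ι × ι => corner (FamilyRing.of U p.1 p.1 (𝟙 (U p.1)))
        (FamilyRing.of U p.2 p.2 (𝟙 (U p.2)))) (j, i) ⟨_, hf⟩,
        DirectSum.coeAddMonoidHom_of _ _ _⟩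

instance : HasEnoughIdempotents (FamilyRing U) := ⟨ι, _, isCompleteOrthogonal_id U⟩

variable (U)

noncomputable instance (X : C) : Module (Dorroh (FamilyRing U))ᵐᵒᵖ (HomSum U X) :=
  moduleOfAction (act U X) act_mul

/-- Postcomposition with `φ : X ⟶ Y`, as an additive map. -/
noncomputable def HomSum.map {X Y : C} (φ : X ⟶ Y) : HomSum U X →+ HomSum U Y :=
  HomSum.lift U fun i => (HomSum.of U i).comp (Preadditive.compHom.flip φ)

variable {U}

lemma HomSum.map_of {X Y : C} (φ : X ⟶ Y) (i : ι) (f : U i ⟶ X) :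
    HomSum.map U φ (HomSum.of U i f) = HomSum.of U i (f ≫ φ) := by
  simp [HomSum.map, Preadditive.compHom, Preadditive.leftComp]

lemma HomSum.map_act {X Y : C} (φ : X ⟶ Y) (r : FamilyRing U) (m : HomSum U X) :
    HomSum.map U φ (act U X r m) = act U Y r (HomSum.map U φ m) := by
  induction m using HomSum.induction with
  | zero => simp
  | add m m' hm hm' => simp only [map_add, hm, hm']
  | of k f =>
    induction r using FamilyRing.induction with
    | zero => simp
    | add r s hr hs => simp only [map_add, AddMonoidHom.add_apply, hr, hs]
    | of i j r =>
      by_cases h : j = k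
      · subst h
        simp only [act_of_of, HomSum.map_of, Category.assoc]
      · simp only [act_of_of_ne h, HomSum.map_of, map_zero]

variable (U)

/-- The right `R`-module `⨁ i, Hom (U i, X)`, where `R = ⨁ i j, Hom (U i, U j)`. -/
noncomputable abbrev homSumMod (X : C) : RightMod (FamilyRing U) :=
  ModuleCat.of (Dorroh (FamilyRing U))ᵐᵒᵖ (HomSum U X)

lemma ract_homSumMod (X : C) (r : FamilyRing U) (m : HomSum U X) :
    ract (homSumMod U X) r m = act U X r m := by
  change (0 : ℤ) • m + act U X r m = _
  simp

lemma isUnitary_homSumMod (X : C) : isUnitary (FamilyRing U) (homSumMod U X) := by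
  refine (AddSubgroup.eq_top_iff' _).2 fun (m : HomSum U X) => ?_
  induction m using HomSum.induction with
  | zero => exact zero_mem _
  | add m m' hm hm' => exact add_mem hm hm'
  | of i f =>
    refine AddSubgroup.subset_closure ⟨FamilyRing.of U i i (𝟙 _), HomSum.of U i f, ?_⟩
    rw [ract_homSumMod, act_of_of, Category.id_comp]

/-- The functor `⨁ i, Hom (U i, -)` from `C` to the unitary right `R`-modules, where
`R = ⨁ i j, Hom (U i, U j)`. -/
noncomputable def homFunctor : C ⥤ UnitaryMod (FamilyRing U) where
  obj X := ⟨homSumMod U X, isUnitary_homSumMod U X⟩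
  map {X Y} φ := ObjectProperty.homMk (ModuleCat.ofHom
    { toFun := HomSum.map U φ
      map_add' := map_add _
      map_smul' := fun a m => by
        change HomSum.map U φ (_ • m + act U X _ m) = _ • HomSum.map U φ m + act U Y _ _
        rw [map_add, map_zsmul, HomSum.map_act]
        rfl })
  map_id X := by
    ext m
    change HomSum.map U (𝟙 X) m = m
    induction m using HomSum.induction with
    | zero => simp
    | add m m' hm hm' => rw [map_add, hm, hm']
    | of i f => rw [HomSum.map_of, Category.comp_id]
  map_comp {X Y Z} φ ψ := by
    ext m
    change HomSum.map U (φ ≫ ψ) m = HomSum.map U ψ (HomSum.map U φ m)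
    induction m using HomSum.induction with
    | zero => simp
    | add m m' hm hm' => rw [map_add, map_add, map_add, hm, hm']
    | of i f => rw [HomSum.map_of, HomSum.map_of, HomSum.map_of, Category.assoc]

end Family

/-! ### Localizing and bilocalizing subcategories -/

section Localizing

variable {A : Type u} [Category.{v} A] [Abelian A]

/-- The Serre subcategory `P` of `A` is localizing: the canonical functor `A ⥤ A/P` to the
quotient category, i.e. the localization of `A` at the morphisms whose kernel and cokernel
belong to `P`, has a right adjoint. -/
def IsLocalizing (P : ObjectProperty A) : Prop :=
  ∃ _ : P.IsSerreClass, P.isoModSerre.Q.IsLeftAdjoint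

/-- The localizing subcategory `P` of `A` is bilocalizing: the canonical functor `A ⥤ A/P` to the
quotient category also has a left adjoint. -/
def IsBilocalizing (P : ObjectProperty A) : Prop :=
  ∃ _ : P.IsSerreClass, P.isoModSerre.Q.IsLeftAdjoint ∧ P.isoModSerre.Q.IsRightAdjoint

/-- `P` is closed under direct products (indexed by small sets). -/
def IsClosedUnderProducts (P : ObjectProperty A) : Prop :=
  ∀ J : Type v, P.IsClosedUnderLimitsOfShape (Discrete J)

end Localizing

/-! ### Grothendieck's condition Ab6 -/

/-- Ab6: for every family, indexed by `j : J`, of directed families of subobjects `L j i`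
(`i : I j`) of an object `M`, one has
`⋂ j, ∑ i, L j i = ∑ φ ∈ ∏ j, I j, ⋂ j, L j (φ j)`. -/
def AB6 (C : Type u) [Category.{v} C] [Abelian C] [IsGrothendieckAbelian.{v} C] : Prop :=
  ∀ (M : C) (J : Type v) (I : J → Type v) (_ : ∀ j, Nonempty (I j))
    (L : ∀ j, I j → Subobject M) (_ : ∀ j, Directed (· ≤ ·) (L j)),
    ⨅ j, ⨆ i, L j i = ⨆ φ : (∀ j, I j), ⨅ j, L j (φ j)

end Roos

namespace Roos

/-! ### Right modules as additive groups with an action of `R` -/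

section Linear

variable {R : Type w} [NonUnitalRing R]

/-! Write G for `homFunctor U`. By a Gabriel–Popescu argument for a family of generators, G is fully
faithful (`homFunctor_full`, `homFunctor_faithful`) and preserves injective objects, so its left
adjoint F is exact (`preservesFiniteLimits_leftAdjoint`). Hence F is, up to an equivalence, the
quotient functor by its kernel, and this kernel is localizing.

The equivalences go through a statement about the generators alone, `CoversInter U`. A right ideal
of morphisms into `X` covers if its members are jointly epimorphic, and `CoversInter U` says that
small intersections of covering right ideals of the `U i` cover. A module is killed by F exactly
when the annihilators of all the elements m · 𝟙 (U i) cover (`kernel_iff`).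

Annihilators in a product are intersections of annihilators, and quotients by covering ideals are
killed by F, so condition 2 is equivalent to `CoversInter U`. Ab6 and Ab4* follow from it because
both only require making a choice for every index at once: of a member of each directed family, or
of a lift of each component. Conversely, a covering ideal is the directed union of its finitely
generated parts; Ab6 interchanges intersection and sum for these parts, and Ab4* covers an
intersection of finitely generated parts by morphisms lying in all the ideals
(`coversInter_of_ab6_of_ab4Star`).

Finally, `CoversInter U` makes F preserve products (`preservesProducts`), hence all limits, and the
adjoint functor theorem gives the left adjoint in condition 3. Conversely, a quotient functor that
is a right adjoint preserves products, so its kernel is closed under them. -/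

lemma Dorroh.eq_fst_add_inr_snd (a : Dorroh R) :
    a = Dorroh.fst a • (1 : Dorroh R) + Dorroh.inr (Dorroh.snd a) := by
  obtain ⟨n, r⟩ := a
  refine Unitization.ext ?_ ?_
  · change n = (n • (1 : Unitization ℤ R)).fst + 0
    rw [Unitization.fst_smul, Unitization.fst_one, smul_eq_mul, mul_one, add_zero]
  · change r = (n • (1 : Unitization ℤ R)).snd + r
    rw [Unitization.snd_smul, Unitization.snd_one, smul_zero, zero_add]

lemma smul_eq_add_ract (M : RightMod R) (a : (Dorroh R)ᵐᵒᵖ) (m : M) :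
    a • m = Dorroh.fst a.unop • m + ract M (Dorroh.snd a.unop) m := by
  have h : a = Dorroh.fst a.unop • (1 : (Dorroh R)ᵐᵒᵖ) +
      MulOpposite.op (Dorroh.inr (Dorroh.snd a.unop)) :=
    MulOpposite.unop_injective (Dorroh.eq_fst_add_inr_snd a.unop)
  rw [ract_apply]
  conv_lhs => rw [h]
  rw [add_smul, smul_assoc, one_smul]

/-- An additive map between right modules which commutes with the action of `R`. -/
def rightModHom {M N : RightMod R} (f : M →+ N)
    (hf : ∀ r m, f (ract M r m) = ract N r (f m)) : M ⟶ N :=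
  ModuleCat.ofHom
    { toFun := f
      map_add' := map_add f
      map_smul' a m := by
        rw [smul_eq_add_ract, map_add, map_zsmul, hf, RingHom.id_apply, smul_eq_add_ract] }

/-- An additive subgroup of a right module which is stable under the action of `R`. -/
def rightSubmodule {M : RightMod R} (S : AddSubgroup M)
    (hS : ∀ r, ∀ m ∈ S, ract M r m ∈ S) : Submodule (Dorroh R)ᵐᵒᵖ M where
  __ := S
  smul_mem' a m hm := by
    rw [smul_eq_add_ract]
    exact add_mem (S := AddSubgroup M) (zsmul_mem (K := S) (show m ∈ S from hm) _) (hS _ _ hm)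

end Linear

/-! ### Coordinates in the direct sum of the groups Hom (U i, X) -/

section Components

variable {C : Type u} [Category.{v} C] [Preadditive C] {ι : Type v} {U : ι → C}

/-- The component at `i` of an element of `⨁ i, Hom (U i, X)`. -/
noncomputable def HomSum.component {X : C} (i : ι) : HomSum U X →+ (U i ⟶ X) :=
  DFinsupp.evalAddMonoidHom (β := fun i => (U i ⟶ X)) i

lemma HomSum.component_of_self {X : C} (i : ι) (f : U i ⟶ X) :
    HomSum.component i (HomSum.of U i f) = f := by
  classical
  exact DirectSum.of_eq_same (β := fun i => (U i ⟶ X)) i f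

lemma HomSum.component_of_ne {X : C} {i j : ι} (h : i ≠ j) (f : U i ⟶ X) :
    HomSum.component j (HomSum.of U i f) = 0 := by
  classical
  exact DirectSum.of_eq_of_ne (β := fun i => (U i ⟶ X)) i j f h.symm

lemma HomSum.ext_component {X : C} {x y : HomSum U X}
    (h : ∀ i, HomSum.component i x = HomSum.component i y) : x = y :=
  DFinsupp.ext (β := fun i => (U i ⟶ X)) h

lemma HomSum.component_act {X : C} {i j : ι} (r : U i ⟶ U j) (x : HomSum U X) :
    HomSum.component i (act U X (FamilyRing.of U i j r) x) = r ≫ HomSum.component j x := by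
  induction x using HomSum.induction with
  | zero => simp
  | add x y hx hy => simp only [map_add, hx, hy, Preadditive.comp_add]
  | of k f =>
    by_cases h : j = k
    · subst h
      rw [act_of_of, component_of_self, component_of_self]
    · rw [act_of_of_ne h, component_of_ne (Ne.symm h), map_zero, comp_zero]

lemma HomSum.act_eq_of {X : C} {i j : ι} (r : U i ⟶ U j) (x : HomSum U X) :
    act U X (FamilyRing.of U i j r) x = HomSum.of U i (r ≫ HomSum.component j x) := by
  induction x using HomSum.induction with
  | zero => simp
  | add x y hx hy => simp only [map_add, hx, hy, Preadditive.comp_add]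
  | of k f =>
    by_cases h : j = k
    · subst h
      rw [act_of_of, component_of_self]
    · rw [act_of_of_ne h, component_of_ne (Ne.symm h), comp_zero, map_zero]

lemma HomSum.component_map {X Y : C} (φ : X ⟶ Y) (i : ι) (x : HomSum U X) :
    HomSum.component i (HomSum.map U φ x) = HomSum.component i x ≫ φ := by
  induction x using HomSum.induction with
  | zero => simp
  | add x y hx hy => simp only [map_add, hx, hy, Preadditive.add_comp]
  | of k f =>
    rw [HomSum.map_of]
    by_cases h : k = i
    · subst h
      rw [component_of_self, component_of_self]
    · rw [component_of_ne h, component_of_ne h, zero_comp]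

end Components

/-! ### Elements of unitary modules and morphisms to G(X) by coordinates -/

section Elements

variable {C : Type u} [Category.{v} C] [Preadditive C] {ι : Type v} {U : ι → C}

lemma ract_eq_zero_of_forall_idem {M : RightMod (FamilyRing U)} {m : M}
    (h : ∀ i, ract M (FamilyRing.of U i i (𝟙 _)) m = 0) (r : FamilyRing U) : ract M r m = 0 := by
  induction r using FamilyRing.induction with
  | zero => simp
  | add r s hr hs => rw [map_add, AddMonoidHom.add_apply, hr, hs, add_zero]
  | of i j f =>
    have := ract_mul M (FamilyRing.of U j j (𝟙 _)) (FamilyRing.of U i j f) m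
    rwa [FamilyRing.of_mul_of, Category.comp_id, h, map_zero] at this

lemma exists_ract_eq_self (M : UnitaryMod (FamilyRing U)) (m : M.obj) :
    ∃ r, ract M.obj r m = m :=
  exists_ract_eq M.obj (by rw [show mulRing M.obj = ⊤ from M.property]; trivial)

/-- An element of a unitary module vanishes as soon as its components do. -/
lemma eq_zero_of_forall_idem {M : UnitaryMod (FamilyRing U)} {m : M.obj}
    (h : ∀ i, ract M.obj (FamilyRing.of U i i (𝟙 _)) m = 0) : m = 0 := by
  obtain ⟨r, hr⟩ := exists_ract_eq_self M m
  rw [← hr, ract_eq_zero_of_forall_idem h]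

/-- All but finitely many components of an element of a unitary module vanish. -/
lemma exists_finset_forall_notMem (M : UnitaryMod (FamilyRing U)) (m : M.obj) :
    ∃ t : Finset ι, ∀ i ∉ t, ract M.obj (FamilyRing.of U i i (𝟙 _)) m = 0 := by
  classical
  obtain ⟨r, hr⟩ := exists_ract_eq_self M m
  suffices h : ∃ t : Finset ι, ∀ i ∉ t,
      ract M.obj (FamilyRing.of U i i (𝟙 _)) (ract M.obj r m) = 0 by rwa [hr] at h
  clear hr
  induction r using FamilyRing.induction with
  | zero => exact ⟨∅, fun i _ => by simp⟩
  | add r s hr hs =>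
    obtain ⟨t, ht⟩ := hr
    obtain ⟨t', ht'⟩ := hs
    refine ⟨t ∪ t', fun i hi => ?_⟩
    rw [Finset.notMem_union] at hi
    rw [map_add, AddMonoidHom.add_apply, map_add, ht i hi.1, ht' i hi.2, add_zero]
  | of k l f =>
    refine ⟨{k}, fun i hi => ?_⟩
    rw [Finset.notMem_singleton] at hi
    rw [← ract_mul, FamilyRing.of_mul_of_ne hi, map_zero, AddMonoidHom.zero_apply]

/-- The coordinates of a morphism of unitary modules with values in `⨁ i, Hom (U i, X)`. -/
noncomputable def coord {M : UnitaryMod (FamilyRing U)} {X : C}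
    (f : M ⟶ (homFunctor U).obj X) (i : ι) : M.obj →+ (U i ⟶ X) :=
  AddMonoidHom.comp (HomSum.component (U := U) (X := X) i) f.hom.hom.toAddMonoidHom

lemma coord_apply {M : UnitaryMod (FamilyRing U)} {X : C}
    (f : M ⟶ (homFunctor U).obj X) (i : ι) (m : M.obj) :
    coord f i m = HomSum.component (U := U) (X := X) i (f.hom m) := rfl

lemma coord_ract {M : UnitaryMod (FamilyRing U)} {X : C}
    (f : M ⟶ (homFunctor U).obj X) {i j : ι} (r : U i ⟶ U j) (m : M.obj) :
    coord f i (ract M.obj (FamilyRing.of U i j r) m) = r ≫ coord f j m := by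
  refine Eq.trans ?_ (HomSum.component_act r (f.hom m : HomSum U X))
  rw [coord_apply, map_ract]
  exact congrArg _ (ract_homSumMod U X _ _)

lemma coord_ext {M : UnitaryMod (FamilyRing U)} {X : C}
    {f g : M ⟶ (homFunctor U).obj X} (h : ∀ i m, coord f i m = coord g i m) : f = g := by
  ext m
  exact HomSum.ext_component fun i => h i m

lemma coord_comp {M N : UnitaryMod (FamilyRing U)} {X : C} (g : M ⟶ N)
    (f : N ⟶ (homFunctor U).obj X) (i : ι) (m : M.obj) :
    coord (g ≫ f) i m = coord f i (g.hom m) := rfl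

lemma coord_comp_map {M : UnitaryMod (FamilyRing U)} {X Y : C}
    (f : M ⟶ (homFunctor U).obj X) (φ : X ⟶ Y) (i : ι) (m : M.obj) :
    coord (f ≫ (homFunctor U).map φ) i m = coord f i m ≫ φ :=
  HomSum.component_map φ i _

lemma coord_zero {M : UnitaryMod (FamilyRing U)} {X : C} (i : ι) (m : M.obj) :
    coord (0 : M ⟶ (homFunctor U).obj X) i m = 0 :=
  map_zero (HomSum.component (U := U) (X := X) i)

/-- Compatibility with the idempotents makes `φ i m` vanish whenever m · 𝟙 (U i) does, hence for
almost all `i`. So families of coordinates take values in the direct sum, and not only in the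
product. -/
lemma exists_component_eq {M : UnitaryMod (FamilyRing U)} {X : C}
    (φ : ∀ i, M.obj →+ (U i ⟶ X))
    (hφ : ∀ i j (r : U i ⟶ U j) m, φ i (ract M.obj (FamilyRing.of U i j r) m) = r ≫ φ j m)
    (m : M.obj) : ∃ x : HomSum U X, ∀ i, HomSum.component i x = φ i m := by
  classical
  obtain ⟨t, ht⟩ := exists_finset_forall_notMem M m
  refine ⟨∑ i ∈ t, HomSum.of U i (φ i m), fun j => ?_⟩
  rw [map_sum]
  by_cases hj : j ∈ t
  · rw [Finset.sum_eq_single_of_mem j hj fun i _ hi => HomSum.component_of_ne hi _,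
      HomSum.component_of_self]
  · rw [Finset.sum_eq_zero fun i hi => HomSum.component_of_ne (by rintro rfl; exact hj hi) _]
    have := hφ j j (𝟙 _) m
    rwa [ht j hj, map_zero, Category.id_comp] at this

/-- A morphism of unitary modules with values in `⨁ i, Hom (U i, X)`, given by its coordinates. -/
noncomputable def ofCoord {M : UnitaryMod (FamilyRing U)} {X : C}
    (φ : ∀ i, M.obj →+ (U i ⟶ X))
    (hφ : ∀ i j (r : U i ⟶ U j) m, φ i (ract M.obj (FamilyRing.of U i j r) m) = r ≫ φ j m) :
    M ⟶ (homFunctor U).obj X :=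
  ObjectProperty.homMk (rightModHom
    (M := M.obj) (N := homSumMod U X)
    (AddMonoidHom.mk' (G := HomSum U X) (fun m => (exists_component_eq φ hφ m).choose)
      fun m n => HomSum.ext_component fun i => by
        rw [map_add, (exists_component_eq φ hφ m).choose_spec,
          (exists_component_eq φ hφ n).choose_spec,
          (exists_component_eq φ hφ (m + n)).choose_spec, map_add])
    (fun r m => by
      refine Eq.trans ?_ (ract_homSumMod U X _ _).symm
      change (exists_component_eq φ hφ _).choose = act U X r (exists_component_eq φ hφ m).choose
      refine HomSum.ext_component fun k => ?_
      rw [(exists_component_eq φ hφ _).choose_spec]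
      induction r using FamilyRing.induction with
      | zero => simp
      | add r s hr hs => simp only [map_add, AddMonoidHom.add_apply, hr, hs]
      | of i j r =>
        rw [HomSum.act_eq_of, (exists_component_eq φ hφ m).choose_spec]
        by_cases h : i = k
        · subst h
          rw [hφ, HomSum.component_of_self]
        · have := hφ k k (𝟙 _) (ract M.obj (FamilyRing.of U i j r) m)
          rw [← ract_mul, FamilyRing.of_mul_of_ne (Ne.symm h), map_zero, AddMonoidHom.zero_apply,
            map_zero, Category.id_comp] at this
          rw [HomSum.component_of_ne h, ← this]))

lemma coord_ofCoord {M : UnitaryMod (FamilyRing U)} {X : C}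
    (φ : ∀ i, M.obj →+ (U i ⟶ X))
    (hφ : ∀ i j (r : U i ⟶ U j) m, φ i (ract M.obj (FamilyRing.of U i j r) m) = r ≫ φ j m)
    (i : ι) (m : M.obj) : coord (ofCoord φ hφ) i m = φ i m :=
  (exists_component_eq φ hφ m).choose_spec i

/-- The element of `⨁ i, Hom (U i, X)` given by a morphism `U i ⟶ X`. -/
noncomputable def elt {X : C} (i : ι) (f : U i ⟶ X) : ((homFunctor U).obj X).obj :=
  HomSum.of U i f

lemma coord_id_elt {X : C} (i : ι) (f : U i ⟶ X) :
    coord (𝟙 ((homFunctor U).obj X)) i (elt i f) = f :=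
  HomSum.component_of_self i f

lemma ract_eq_elt {X : C} {i j : ι} (r : U i ⟶ U j) (x : ((homFunctor U).obj X).obj) :
    ract _ (FamilyRing.of U i j r) x = elt i (r ≫ coord (𝟙 _) j x) :=
  (ract_homSumMod U X _ x).trans (HomSum.act_eq_of _ _)

lemma ract_elt {X : C} {i j : ι} (r : U i ⟶ U j) (f : U j ⟶ X) :
    ract _ (FamilyRing.of U i j r) (elt j f) = elt i (r ≫ f) := by
  rw [ract_eq_elt, coord_id_elt]

/-- The morphism `Hom (-, U i) ⟶ M` determined by the element `m · 𝟙 (U i)`. -/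
noncomputable def ofElement (M : UnitaryMod (FamilyRing U)) (i : ι) (m : M.obj) :
    (homFunctor U).obj (U i) ⟶ M :=
  ObjectProperty.homMk (rightModHom (M := homSumMod U (U i)) (N := M.obj)
    (HomSum.lift U fun k => (AddMonoidHom.eval m).comp ((ract M.obj).comp (FamilyRing.of U k i)))
    (fun r x => by
      rw [show ract (homSumMod U (U i)) r x = act U (U i) r x from ract_homSumMod U (U i) r x]
      induction r using FamilyRing.induction with
      | zero => simp
      | add r s hr hs => simp only [map_add, AddMonoidHom.add_apply, hr, hs]
      | of k l r =>
        induction (x : HomSum U (U i)) using HomSum.induction with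
        | zero => simp
        | add x y hx hy => simp only [map_add, hx, hy]
        | of j f =>
          simp only [HomSum.lift_of, AddMonoidHom.comp_apply, AddMonoidHom.eval_apply_apply]
          rw [← ract_mul]
          by_cases h : l = j
          · subst h
            rw [act_of_of, FamilyRing.of_mul_of, HomSum.lift_of]
            rfl
          · rw [act_of_of_ne h, FamilyRing.of_mul_of_ne h]
            simp))

lemma ofElement_elt (M : UnitaryMod (FamilyRing U)) (i : ι) (m : M.obj) (k : ι)
    (f : U k ⟶ U i) : (ofElement M i m).hom (elt k f) = ract M.obj (FamilyRing.of U k i f) m :=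
  HomSum.lift_of (X := U i) (fun k => (AddMonoidHom.eval m).comp
    ((ract M.obj).comp (FamilyRing.of U k i))) k f

lemma ract_ofElement (M : UnitaryMod (FamilyRing U)) (i : ι) (m : M.obj) {k l : ι}
    (r : U k ⟶ U l) (x : ((homFunctor U).obj (U i)).obj) :
    ract M.obj (FamilyRing.of U k l r) ((ofElement M i m).hom x) =
      ract M.obj (FamilyRing.of U k i (r ≫ coord (𝟙 _) l x)) m := by
  rw [← map_ract, ract_eq_elt, ofElement_elt]

end Elements

/-! ### Colimits and exactness of filtered colimits in MOD R -/

section Unitary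

variable {R : Type w} [NonUnitalRing R]

/-- The projection from a colimit M to M / MR kills the image of every unitary module of the
diagram, hence is zero. -/
instance (J : Type*) [Category* J] : (isUnitary R).IsClosedUnderColimitsOfShape J where
  colimitsOfShape_le := by
    rintro M ⟨p⟩
    let S := rightSubmodule (mulRing M) fun r m _ => AddSubgroup.subset_closure ⟨r, m, rfl⟩
    have h : ModuleCat.ofHom S.mkQ = 0 := p.isColimit.hom_ext fun j => by
      ext x
      have hx : x ∈ mulRing (p.diag.obj j) := by
        rw [show mulRing (p.diag.obj j) = ⊤ from p.prop_diag_obj j]; trivial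
      exact (Submodule.Quotient.mk_eq_zero S).2 (map_mem_mulRing (p.ι.app j) hx)
    refine (AddSubgroup.eq_top_iff' _).2 fun x => ?_
    exact (Submodule.Quotient.mk_eq_zero S).1 (congrArg (fun f : M ⟶ _ => f x) h)

variable [HasEnoughIdempotents R]

instance : PreservesFiniteLimits (isUnitary R).ι := by
  have := (isUnitary R).preservesKernels_ι
  have : (isUnitary R).ι.Additive := inferInstance
  exact Functor.preservesFiniteLimits_of_preservesKernels _

instance : HasColimitsOfSize.{w, w} (UnitaryMod R) where
  has_colimits_of_shape _ _ := inferInstance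

instance : AB5 (UnitaryMod R) where
  ofShape J _ _ := HasExactColimitsOfShape.domain_of_functor J (isUnitary R).ι

end Unitary

/-! ### MOD R is a Grothendieck category -/

section Separator

variable {C : Type u} [Category.{v} C] [Preadditive C] {ι : Type v} {U : ι → C}

lemma unitaryMod_hom_eq_zero {M N : UnitaryMod (FamilyRing U)} (f : M ⟶ N)
    (h : ∀ m : M.obj, f.hom m = 0) : f = 0 := by
  ext m
  exact h m

variable (U) in
-- The element m · 𝟙 (U i) is the image of 𝟙 (U i) under `ofElement M i m`, and a unitary module has
-- no nonzero element all of whose components m · 𝟙 (U i) vanish.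
lemma isSeparating_homFunctor_obj :
    (ObjectProperty.ofObj fun i => (homFunctor U).obj (U i)).IsSeparating := by
  rw [Preadditive.isSeparating_iff]
  intro M N f hf
  refine unitaryMod_hom_eq_zero f fun m => eq_zero_of_forall_idem fun i => ?_
  have h := hf _ (ObjectProperty.ofObj_apply _ i) (ofElement M i m)
  rw [← map_ract, ← ofElement_elt]
  exact congrArg (fun g : (homFunctor U).obj (U i) ⟶ N => g.hom (elt i (𝟙 _))) h

variable (U) in
-- Each G(U i) is a retract of G(∐ U), so there is no need for G to preserve the coproduct.
lemma isSeparator_homFunctor_sigma [HasCoproduct U] :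
    IsSeparator ((homFunctor U).obj (∐ U)) := by
  classical
  rw [Preadditive.isSeparator_iff]
  intro M N f hf
  refine (Preadditive.isSeparating_iff _).1 (isSeparating_homFunctor_obj U) f ?_
  rintro _ ⟨i⟩ g
  have h := hf ((homFunctor U).map (Sigma.π U i) ≫ g)
  have h' : (homFunctor U).map (Sigma.ι U i) ≫ (homFunctor U).map (Sigma.π U i) = 𝟙 _ := by
    rw [← Functor.map_comp]
    simp
  rw [← Category.id_comp g, ← h', Category.assoc, Category.assoc, ← Category.assoc _ g, h,
    comp_zero]

instance [HasCoproduct U] : IsGrothendieckAbelian.{v} (UnitaryMod (FamilyRing U)) where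
  hasSeparator := ⟨_, isSeparator_homFunctor_sigma U⟩

end Separator

/-! ### G preserves limits and has a left adjoint -/

section Adjoint

variable {C : Type u} [Category.{v} C] [Preadditive C] {ι : Type v} (U : ι → C)

/-- The cone with point `U i` given by an element of the point of a cone. -/
noncomputable def coordCone {J : Type*} [Category* J] {D : J ⥤ C} (s : Cone (D ⋙ homFunctor U))
    (i : ι) (m : s.pt.obj) : Cone D where
  pt := U i
  π :=
    { app j := coord (X := D.obj j) (s.π.app j) i m
      naturality j k f := by
        refine Eq.trans ?_ (coord_comp_map _ (D.map f) i m)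
        refine (Category.id_comp _).trans ?_
        rw [show s.π.app j ≫ (homFunctor U).map (D.map f) = s.π.app k from s.w f] }

/-- The morphism from `U i` to a limit given by an element of the point of a cone. -/
noncomputable def coordLift {J : Type*} [Category* J] {D : J ⥤ C} {c : Cone D} (hc : IsLimit c)
    (s : Cone (D ⋙ homFunctor U)) (i : ι) (m : s.pt.obj) : U i ⟶ c.pt :=
  hc.lift (coordCone U s i m)

lemma coordLift_π {J : Type*} [Category* J] {D : J ⥤ C} {c : Cone D} (hc : IsLimit c)
    (s : Cone (D ⋙ homFunctor U)) (i : ι) (m : s.pt.obj) (j : J) :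
    coordLift U hc s i m ≫ c.π.app j = coord (X := D.obj j) (s.π.app j) i m :=
  hc.fac _ j

/-- A morphism from M to G(X) is a compatible family of maps from M to Hom (U i, X), and each Hom (U
i, -) preserves limits. The direct sum is harmless, since the finite support is controlled by the
element of M. -/
instance : PreservesLimitsOfSize (homFunctor U) where
  preservesLimitsOfShape {J} _ :=
    { preservesLimit {D} :=
        { preserves {c} hc := ⟨
            { lift s := ofCoord
                (fun i => AddMonoidHom.mk' (coordLift U hc s i) fun m n =>
                  hc.hom_ext fun j => by
                    simp only [Preadditive.add_comp, coordLift_π, map_add])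
                (fun i k r m => hc.hom_ext fun j => by
                  simp only [AddMonoidHom.mk'_apply, Category.assoc, coordLift_π]
                  exact coord_ract (X := D.obj j) (s.π.app j) r m)
              fac s j := coord_ext (X := D.obj j) fun i m => by
                refine (coord_comp_map _ (c.π.app j) i m).trans ?_
                rw [coord_ofCoord]
                exact coordLift_π U hc s i m j
              uniq s f hf := coord_ext fun i m => hc.hom_ext fun j => by
                rw [coord_ofCoord]
                refine (coord_comp_map _ (c.π.app j) i m).symm.trans ?_
                rw [show f ≫ (homFunctor U).map (c.π.app j) = s.π.app j from hf j]
                exact (coordLift_π U hc s i m j).symm }⟩ } }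

end Adjoint

section

variable {C : Type u} [Category.{v} C] [Abelian C] [IsGrothendieckAbelian.{v} C] {ι : Type v}

/-- The special adjoint functor theorem applies, a Grothendieck category having a coseparator. -/
instance (U : ι → C) : (homFunctor U).IsRightAdjoint :=
  isRightAdjoint_of_preservesLimits_of_isCoseparating.{v} (isCoseparator_coseparator _) _

end

section

variable {C : Type u} [Category.{v} C] [Preadditive C] {ι : Type v} {U : ι → C}

lemma coord_ract_of_ne {M : UnitaryMod (FamilyRing U)} {X : C}
    (f : M ⟶ (homFunctor U).obj X) {i j k : ι} (h : i ≠ k) (r : U i ⟶ U j) (m : M.obj) :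
    coord f k (ract M.obj (FamilyRing.of U i j r) m) = 0 := by
  have := coord_ract f (𝟙 (U k)) (ract M.obj (FamilyRing.of U i j r) m)
  rwa [← ract_mul, FamilyRing.of_mul_of_ne h.symm, map_zero, AddMonoidHom.zero_apply, map_zero,
    Category.id_comp, eq_comm] at this

lemma injective_of_mono {R : Type w} [NonUnitalRing R] [HasEnoughIdempotents R]
    {M N : UnitaryMod R} (f : M ⟶ N) [Mono f] : Function.Injective f.hom :=
  (ModuleCat.mono_iff_injective _).1 (inferInstanceAs (Mono ((isUnitary R).ι.map f)))

lemma eq_zero_of_coord_eq_zero {M : UnitaryMod (FamilyRing U)} {X : C}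
    (g : M ⟶ (homFunctor U).obj X) [Mono g] {m : M.obj} (h : ∀ i, coord g i m = 0) : m = 0 := by
  refine injective_of_mono g ?_
  rw [map_zero]
  exact HomSum.ext_component (U := U) (X := X) fun i => (h i).trans (map_zero _).symm

end

/-! ### The Gabriel–Popescu theorem for a family of generators -/

section GabrielPopescu

variable {C : Type u} [Category.{v} C] [Abelian C] {ι : Type v} {U : ι → C}

lemma homFunctor_faithful (hU : (ObjectProperty.ofObj U).IsSeparating) :
    (homFunctor U).Faithful where
  map_injective {X Y} f g h := by
    refine hU f g ?_
    rintro _ ⟨i⟩ t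
    have := congrArg (fun e => coord e i (elt i t)) ((𝟙 _ : _ ⟶ (homFunctor U).obj X) ≫= h)
    simpa only [coord_comp_map, coord_id_elt] using this

lemma preservesFiniteColimits_leftAdjoint {F : UnitaryMod (FamilyRing U) ⥤ C}
    (adj : F ⊣ homFunctor U) : PreservesFiniteColimits F := by
  have := adj.leftAdjoint_preservesColimits.{0, 0}
  infer_instance

variable [IsGrothendieckAbelian.{v} C]

/-- The morphism `∐ U i ⟶ A`, where the coproduct is taken over the elements `m` of `M` and the
indices `i`, induced by a morphism from `M` to `⨁ i, Hom (U i, A)`. -/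
noncomputable def sigmaDesc {M : UnitaryMod (FamilyRing U)} {A : C}
    (g : M ⟶ (homFunctor U).obj A) : (∐ fun p : (_ : ι) × M.obj => U p.1) ⟶ A :=
  Sigma.desc fun p => coord g p.1 p.2

lemma ι_sigmaDesc {M : UnitaryMod (FamilyRing U)} {A : C}
    (g : M ⟶ (homFunctor U).obj A) (p : (_ : ι) × M.obj) :
    Sigma.ι (fun p : (_ : ι) × M.obj => U p.1) p ≫ sigmaDesc g = coord g p.1 p.2 := by
  simp [sigmaDesc]

lemma ι_sigmaDesc_assoc {M : UnitaryMod (FamilyRing U)} {A Y : C}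
    (g : M ⟶ (homFunctor U).obj A) (p : (_ : ι) × M.obj) (h : A ⟶ Y) :
    Sigma.ι (fun p : (_ : ι) × M.obj => U p.1) p ≫ sigmaDesc g ≫ h = coord g p.1 p.2 ≫ h := by
  rw [← Category.assoc, ι_sigmaDesc]

open CoproductsFromFiniteFiltered

attribute [local instance] IsFiltered.isConnected in
/-- In a Grothendieck category, the vanishing of a morphism factoring through a coproduct may be
tested on generators which factor through a finite subcoproduct. -/
lemma comp_eq_zero_of_forall_finset_sum (hU : (ObjectProperty.ofObj U).IsSeparating)
    {β : Type v} (V : β → C) {K Y : C} (k : K ⟶ ∐ V) (g : ∐ V ⟶ Y)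
    (h : ∀ (i : ι) (t : U i ⟶ K) (F : Finset β) (r : ∀ b, U i ⟶ V b),
      t ≫ k = ∑ b ∈ F, r b ≫ Sigma.ι V b → t ≫ k ≫ g = 0) : k ≫ g = 0 := by
  classical
  -- By exactness of filtered colimits it suffices to treat the pullbacks of `k` to the finite
  -- subcoproducts.
  refine (isColimitFiniteSubproductsCocone V).pullback_zero_ext (fun F => ?_)
  refine (Preadditive.isSeparating_iff _).1 hU _ ?_
  rintro _ ⟨i⟩ t
  let a : U i ⟶ ∐ fun x : F => V x.1.as := t ≫ pullback.fst _ _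
  have ha : t ≫ pullback.snd _ _ ≫ k =
      ∑ x ∈ F.attach, (a ≫ Sigma.π (fun x : F => V x.1.as) x) ≫ Sigma.ι V x.1.as := by
    have h₁ := t ≫= pullback.condition
      (f := (finiteSubcoproductsCocone V).ι.app F) (g := k)
    refine h₁.symm.trans ?_
    have h₂ := finiteSubcoproductsCocone_ι_app_eq_sum V F
    simp only [Category.assoc, ← Preadditive.comp_sum]
    exact (Category.assoc _ _ _).symm.trans (a ≫= h₂)
  -- The components of `a`, extended by zero outside `F`.
  let r (b : β) : U i ⟶ V b :=
    if hb : Discrete.mk b ∈ F then a ≫ Sigma.π (fun x : F => V x.1.as) ⟨Discrete.mk b, hb⟩ else 0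
  have := h i (t ≫ pullback.snd _ _) (F.image Discrete.as) r (by
    rw [Category.assoc, ha, Finset.sum_image (by rintro ⟨x⟩ _ ⟨y⟩ _ rfl; rfl),
      ← Finset.sum_attach F]
    refine Finset.sum_congr rfl fun x _ => ?_
    dsimp only [r]
    rw [dif_pos x.2])
  rwa [Category.assoc] at this

/-- Let `M` be a submodule of `⨁ i, Hom (U i, A)`. A morphism from `M` to `⨁ i, Hom (U i, B)`
induces a morphism to `B` from the image of `∐ U i` in `A`. -/
theorem kernel_ι_sigmaDesc_comp_sigmaDesc (hU : (ObjectProperty.ofObj U).IsSeparating) {A B : C}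
    {M : UnitaryMod (FamilyRing U)} (g : M ⟶ (homFunctor U).obj A) [Mono g]
    (f : M ⟶ (homFunctor U).obj B) : kernel.ι (sigmaDesc g) ≫ sigmaDesc f = 0 := by
  refine comp_eq_zero_of_forall_finset_sum hU _ _ _ fun i t F r h => ?_
  -- A single element of `M`, the sum of the p.2 · r p, computes the composite for `g` and for `f`
  -- alike.
  have key : ∀ {X : C} (e : M ⟶ (homFunctor U).obj X), t ≫ kernel.ι _ ≫ sigmaDesc e =
      coord e i (∑ p ∈ F, ract M.obj (FamilyRing.of U i p.1 (r p)) p.2) := by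
    intro X e
    rw [← Category.assoc, h, Preadditive.sum_comp, map_sum]
    simp only [Category.assoc, ι_sigmaDesc, coord_ract]
  -- Since `g` is mono, this element is zero: its `i`-th coordinate vanishes because `t` lands in
  -- the kernel, and the others because it lies in M · 𝟙 (U i).
  rw [key, eq_zero_of_coord_eq_zero g (m := ∑ p ∈ F, _), map_zero]
  intro l
  by_cases hl : i = l
  · subst hl
    rw [← key, kernel.condition, comp_zero]
  · rw [map_sum]
    exact Finset.sum_eq_zero fun p _ => coord_ract_of_ne g hl _ _

/-- `sigmaDesc f` kills the kernel of `sigmaDesc g`, so it factors through the image of `sigmaDesc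
g`; injectivity of `B` extends the factorization to `A`. This is the extension property needed for
the injectivity of G(B). -/
lemma exists_sigmaDesc_comp_eq (hU : (ObjectProperty.ofObj U).IsSeparating) {A B : C}
    [Injective B] {M : UnitaryMod (FamilyRing U)} (g : M ⟶ (homFunctor U).obj A) [Mono g]
    (f : M ⟶ (homFunctor U).obj B) : ∃ l : A ⟶ B, sigmaDesc g ≫ l = sigmaDesc f := by
  let l₁ : image (sigmaDesc g) ⟶ B :=
    Abelian.epiDesc (factorThruImage (sigmaDesc g)) (sigmaDesc f) (by
      rw [← kernelFactorThruImage_hom_comp_ι, Category.assoc,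
        kernel_ι_sigmaDesc_comp_sigmaDesc hU, comp_zero])
  refine ⟨Injective.factorThru l₁ (image.ι (sigmaDesc g)), ?_⟩
  conv_lhs => congr; rw [← image.fac (sigmaDesc g)]
  rw [Category.assoc, Injective.comp_factorThru, Abelian.comp_epiDesc]

/-- For M = G(A) and the identity as embedding, `sigmaDesc` is an epimorphism onto `A`, every `t : U
i ⟶ A` occurring as the coordinate of `elt i t`. So `sigmaDesc f` descends to the required morphism
from `A` to `B`. -/
lemma homFunctor_full (hU : (ObjectProperty.ofObj U).IsSeparating) : (homFunctor U).Full where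
  map_surjective {A B} f := by
    have : Epi (sigmaDesc (𝟙 ((homFunctor U).obj A))) := by
      rw [Preadditive.epi_iff_cancel_zero]
      intro Y g hg
      refine (Preadditive.isSeparating_iff _).1 hU _ ?_
      rintro _ ⟨i⟩ t
      have := Sigma.ι (fun p : (_ : ι) × ((homFunctor U).obj A).obj => U p.1) ⟨i, elt i t⟩ ≫= hg
      rwa [ι_sigmaDesc_assoc, coord_id_elt, comp_zero] at this
    have h := kernel_ι_sigmaDesc_comp_sigmaDesc hU (𝟙 ((homFunctor U).obj A)) f
    refine ⟨Abelian.epiDesc _ _ h, coord_ext fun i m => ?_⟩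
    have := Sigma.ι (fun p : (_ : ι) × ((homFunctor U).obj A).obj => U p.1) ⟨i, m⟩ ≫=
      Abelian.comp_epiDesc _ _ h
    rw [ι_sigmaDesc_assoc, ι_sigmaDesc] at this
    rw [← this, ← coord_comp_map, Category.id_comp]

lemma homFunctor_preservesInjectiveObjects (hU : (ObjectProperty.ofObj U).IsSeparating) :
    (homFunctor U).PreservesInjectiveObjects where
  injective_obj {B} hB := by
    -- Baer's criterion: extensions need only be found along the inclusions of subobjects of the
    -- separator G(∐ U), which are embeddings of the kind treated in `exists_sigmaDesc_comp_eq`.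
    rw [injective_iff_rlp_monomorphisms_zero,
      ← IsGrothendieckAbelian.generatingMonomorphisms_rlp (isSeparator_homFunctor_sigma U)]
    rintro _ _ _ ⟨N⟩
    refine ⟨fun {f _} _ => ⟨⟨?_⟩⟩⟩
    have h := exists_sigmaDesc_comp_eq hU N.arrow f
    refine
      { l := (homFunctor U).map h.choose
        fac_left := coord_ext fun i m => ?_
        fac_right := (isZero_zero _).eq_of_tgt _ _ }
    rw [coord_comp_map]
    have := Sigma.ι (fun p : (_ : ι) × (N : UnitaryMod (FamilyRing U)).obj => U p.1) ⟨i, m⟩ ≫=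
      h.choose_spec
    rwa [ι_sigmaDesc_assoc, ι_sigmaDesc] at this

/-- A left adjoint preserves monomorphisms if its right adjoint preserves injectives and there are
enough of these. Together with right exactness this gives exactness. -/
lemma preservesFiniteLimits_leftAdjoint {F : UnitaryMod (FamilyRing U) ⥤ C} (adj : F ⊣ homFunctor U)
    (hU : (ObjectProperty.ofObj U).IsSeparating) :
    PreservesFiniteLimits F := by
  have := homFunctor_preservesInjectiveObjects hU
  have : F.IsLeftAdjoint := adj.isLeftAdjoint
  have : F.PreservesMonomorphisms :=
    F.preservesMonomorphisms_of_adjunction_of_preservesInjectiveObjects adj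
  have : PreservesBinaryBiproducts F :=
    preservesBinaryBiproducts_of_preservesBinaryCoproducts _
  have : F.Additive := Functor.additive_of_preservesBinaryBiproducts _
  have : F.PreservesHomology := F.preservesHomology_of_preservesMonos_and_cokernels
  exact F.preservesFiniteLimits_of_preservesHomology

lemma isLocalization_leftAdjoint {F : UnitaryMod (FamilyRing U) ⥤ C} (adj : F ⊣ homFunctor U)
    (hU : (ObjectProperty.ofObj U).IsSeparating) :
    ∃ _ : F.kernel.IsSerreClass, F.IsLocalization F.kernel.isoModSerre := by
  have := preservesFiniteLimits_leftAdjoint adj hU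
  have := preservesFiniteColimits_leftAdjoint adj
  have := homFunctor_full hU
  have := homFunctor_faithful hU
  exact ⟨inferInstance, Abelian.isLocalization_isoModSerre_kernel_of_leftAdjoint adj⟩

/-- The functor `F` is the quotient functor up to an equivalence of categories. -/
lemma exists_iso_comp_equivalence {F : UnitaryMod (FamilyRing U) ⥤ C} (adj : F ⊣ homFunctor U)
    (hU : (ObjectProperty.ofObj U).IsSeparating) :
    ∃ (_ : F.kernel.IsSerreClass) (e : C ≌ F.kernel.isoModSerre.Localization),
      Nonempty (F ⋙ e.functor ≅ F.kernel.isoModSerre.Q) := by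
  obtain ⟨h, _⟩ := isLocalization_leftAdjoint adj hU
  exact ⟨h, Localization.uniq F F.kernel.isoModSerre.Q F.kernel.isoModSerre,
    ⟨Localization.compUniqFunctor _ _ _⟩⟩

theorem isLocalizing_kernel {F : UnitaryMod (FamilyRing U) ⥤ C} (adj : F ⊣ homFunctor U)
    (hU : (ObjectProperty.ofObj U).IsSeparating) :
    IsLocalizing F.kernel := by
  obtain ⟨h, e, ⟨i⟩⟩ := exists_iso_comp_equivalence adj hU
  have := adj.isLeftAdjoint
  exact ⟨h, Functor.isLeftAdjoint_of_iso i⟩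

end GabrielPopescu

/-! ### Covering right ideals and annihilators -/

section RightIdeal

variable {C : Type u} [Category.{v} C] [Preadditive C] {ι : Type v}

/-- A right ideal of morphisms from the objects `U k` to `X`. -/
structure RightIdeal (U : ι → C) (X : C) where
  /-- The morphisms from `U k` which belong to the ideal. -/
  carrier (k : ι) : AddSubgroup (U k ⟶ X)
  comp_mem {k l : ι} (s : U k ⟶ U l) {r : U l ⟶ X} : r ∈ carrier l → s ≫ r ∈ carrier k

variable {U : ι → C}

/-- A right ideal covers `X` if its morphisms are jointly epimorphic. -/
def RightIdeal.Covers {X : C} (a : RightIdeal U X) : Prop :=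
  ∀ ⦃Y : C⦄ (g : X ⟶ Y), (∀ k, ∀ r ∈ a.carrier k, r ≫ g = 0) → g = 0

lemma RightIdeal.Covers.mono {X : C} {a b : RightIdeal U X} (ha : a.Covers)
    (h : ∀ k, a.carrier k ≤ b.carrier k) : b.Covers :=
  fun _ g hg => ha g fun k r hr => hg k r (h k hr)

/-- The intersection of a family of right ideals. -/
def RightIdeal.inter {X : C} {J : Type*} (a : J → RightIdeal U X) : RightIdeal U X where
  carrier k := ⨅ j, (a j).carrier k
  comp_mem s r hr := by
    rw [AddSubgroup.mem_iInf] at hr ⊢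
    exact fun j => (a j).comp_mem s (hr j)

lemma RightIdeal.mem_inter {X : C} {J : Type*} {a : J → RightIdeal U X} {k : ι} {r : U k ⟶ X} :
    r ∈ (RightIdeal.inter a).carrier k ↔ ∀ j, r ∈ (a j).carrier k :=
  AddSubgroup.mem_iInf

variable (U) in
/-- Arbitrary intersections of covering right ideals of the objects `U i` are covering. -/
def CoversInter : Prop :=
  ∀ (i : ι) (J : Type v) (a : J → RightIdeal U (U i)), (∀ j, (a j).Covers) →
    (RightIdeal.inter a).Covers

/-- The annihilator of `m · 𝟙 (U i)`. -/
noncomputable def annihilator (M : UnitaryMod (FamilyRing U)) (i : ι) (m : M.obj) :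
    RightIdeal U (U i) where
  carrier k := ((AddMonoidHom.eval m).comp ((ract M.obj).comp (FamilyRing.of U k i))).ker
  comp_mem {k l} s r hr := by
    rw [AddMonoidHom.mem_ker] at hr ⊢
    change ract M.obj _ m = 0 at hr
    change ract M.obj _ m = 0
    rw [← FamilyRing.of_mul_of, ract_mul, hr, map_zero]

lemma mem_annihilator {M : UnitaryMod (FamilyRing U)} {i : ι} {m : M.obj} {k : ι}
    {r : U k ⟶ U i} :
    r ∈ (annihilator M i m).carrier k ↔ ract M.obj (FamilyRing.of U k i r) m = 0 := Iff.rfl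

lemma hom_ext_elt {X : C} {M : UnitaryMod (FamilyRing U)} {f g : (homFunctor U).obj X ⟶ M}
    (h : ∀ k (r : U k ⟶ X), f.hom (elt k r) = g.hom (elt k r)) : f = g := by
  ext (x : HomSum U X)
  induction x using HomSum.induction with
  | zero => exact (map_zero f.hom.hom).trans (map_zero g.hom.hom).symm
  | add x y hx hy =>
    exact (map_add f.hom.hom x y).trans ((congrArg₂ _ hx hy).trans (map_add g.hom.hom x y).symm)
  | of k r => exact h k r

lemma ofElement_eq_zero {M : UnitaryMod (FamilyRing U)} (i : ι) : ofElement M i 0 = 0 :=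
  hom_ext_elt fun k r => by
    rw [ofElement_elt, map_zero]
    rfl

lemma ofElement_comp {M N : UnitaryMod (FamilyRing U)} (i : ι) (m : M.obj) (f : M ⟶ N) :
    ofElement M i m ≫ f = ofElement N i (f.hom m) :=
  hom_ext_elt fun k r => by
    rw [ofElement_elt, ← map_ract, ← ofElement_elt]
    rfl

/-- The projections of a limit of unitary modules are jointly injective. -/
lemma eq_zero_of_isLimit {J : Type*} [Category* J] {D : J ⥤ UnitaryMod (FamilyRing U)}
    {c : Cone D} (hc : IsLimit c) {m : c.pt.obj} (h : ∀ j, (c.π.app j).hom m = 0) : m = 0 := by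
  refine eq_zero_of_forall_idem fun i => ?_
  -- Limits in MOD R need not be limits of the underlying modules, so the element is replaced by the
  -- morphism from G(U i) that it defines.
  have : ofElement c.pt i m = 0 := hc.hom_ext fun j => by
    rw [ofElement_comp, h, zero_comp]
    exact ofElement_eq_zero i
  rw [← ofElement_elt, this]
  rfl

/-- The submodule of `⨁ k, Hom (U k, X)` given by a right ideal. -/
noncomputable def RightIdeal.submodule {X : C} (a : RightIdeal U X) :
    Submodule (Dorroh (FamilyRing U))ᵐᵒᵖ (homSumMod U X) :=
  rightSubmodule (M := homSumMod U X)
    (⨅ k, (a.carrier k).comap (HomSum.component (U := U) (X := X) k)) (fun r m hm => by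
      rw [ract_homSumMod]
      rw [AddSubgroup.mem_iInf] at hm
      induction r using FamilyRing.induction with
      | zero => simp
      | add r s hr hs =>
        rw [map_add, AddMonoidHom.add_apply]
        exact add_mem hr hs
      | of i j r =>
        rw [AddSubgroup.mem_iInf]
        intro k
        rw [HomSum.act_eq_of, AddSubgroup.mem_comap]
        by_cases h : i = k
        · subst h
          rw [HomSum.component_of_self]
          exact a.comp_mem r (hm j)
        · rw [HomSum.component_of_ne h]
          exact zero_mem _)

/-- The quotient of `⨁ k, Hom (U k, X)` by a right ideal. -/
noncomputable def RightIdeal.quotient {X : C} (a : RightIdeal U X) : UnitaryMod (FamilyRing U) where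
  obj := ModuleCat.of _ (homSumMod U X ⧸ a.submodule)
  property := by
    have : Epi (ModuleCat.ofHom a.submodule.mkQ) :=
      (ModuleCat.epi_iff_surjective _).2 a.submodule.mkQ_surjective
    exact (isUnitary _).prop_of_epi (ModuleCat.ofHom a.submodule.mkQ) (isUnitary_homSumMod U X)

/-- The projection to the quotient by a right ideal. -/
noncomputable def RightIdeal.proj {X : C} (a : RightIdeal U X) :
    (homFunctor U).obj X ⟶ a.quotient :=
  ObjectProperty.homMk (ModuleCat.ofHom a.submodule.mkQ)

instance {X : C} (a : RightIdeal U X) : Epi a.proj := by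
  refine (isUnitary _).ι.epi_of_epi_map ?_
  exact (ModuleCat.epi_iff_surjective (ModuleCat.ofHom a.submodule.mkQ)).2
    a.submodule.mkQ_surjective

lemma RightIdeal.proj_elt_eq_zero_iff {X : C} (a : RightIdeal U X) {k : ι} (r : U k ⟶ X) :
    a.proj.hom (elt k r) = 0 ↔ r ∈ a.carrier k := by
  refine (Submodule.Quotient.mk_eq_zero a.submodule).trans ?_
  change HomSum.of U k r ∈ (⨅ k, (a.carrier k).comap (HomSum.component (U := U) (X := X) k)) ↔ _
  rw [AddSubgroup.mem_iInf]
  refine ⟨fun h => ?_, fun h l => ?_⟩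
  · have := h k
    rwa [AddSubgroup.mem_comap, HomSum.component_of_self] at this
  · rw [AddSubgroup.mem_comap]
    by_cases hl : k = l
    · subst hl
      rwa [HomSum.component_of_self]
    · rw [HomSum.component_of_ne hl]
      exact zero_mem _

end RightIdeal

/-! ### The modules killed by F, and products of such modules -/

section Kernel

variable {C : Type u} [Category.{v} C] [Abelian C] {ι : Type v} {U : ι → C}

lemma kernel_of_unit_eq_zero {F : UnitaryMod (FamilyRing U) ⥤ C} (adj : F ⊣ homFunctor U)
    {M : UnitaryMod (FamilyRing U)} (h : adj.unit.app M = 0) :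
    F.kernel M := by
  refine (IsZero.iff_id_eq_zero _).2 ((adj.homEquiv _ _).injective ?_)
  rw [adj.homEquiv_unit, adj.homEquiv_unit, h, zero_comp, zero_comp]

variable [IsGrothendieckAbelian.{v} C]

/-- A morphism to `⨁ i, Hom (U i, Y)` which vanishes on the kernel of a morphism to a module killed
by `F` is zero. -/
lemma eq_zero_of_kernel_ι_comp_eq_zero {F : UnitaryMod (FamilyRing U) ⥤ C} (adj : F ⊣ homFunctor U)
    (hU : (ObjectProperty.ofObj U).IsSeparating)
    {M : UnitaryMod (FamilyRing U)} (hM : F.kernel M) {N : UnitaryMod (FamilyRing U)}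
    (p : N ⟶ M) {Y : C} (g : N ⟶ (homFunctor U).obj Y) (hg : kernel.ι p ≫ g = 0) : g = 0 := by
  have := preservesFiniteLimits_leftAdjoint adj hU
  have := preservesFiniteColimits_leftAdjoint adj
  have : F.Additive := F.additive_of_preserves_binary_products
  have hS := (ShortComplex.exact_of_f_is_kernel
    -- As F is exact and F(M) = 0, the image under F of the kernel inclusion is an epimorphism.
    (ShortComplex.mk (kernel.ι p) p (kernel.condition p)) (kernelIsKernel p)).map F
  have : Epi (F.map (kernel.ι p)) := hS.epi_f (IsZero.eq_of_tgt hM _ _)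
  refine (adj.homEquiv _ _).symm.injective ?_
  rw [← cancel_epi (F.map (kernel.ι p))]
  rw [← adj.homEquiv_naturality_left_symm, ← adj.homEquiv_naturality_left_symm, hg, comp_zero]

/-- The unitary modules killed by `F` are those whose elements have covering annihilators. -/
theorem kernel_iff {F : UnitaryMod (FamilyRing U) ⥤ C} (adj : F ⊣ homFunctor U)
    (hU : (ObjectProperty.ofObj U).IsSeparating) (M : UnitaryMod (FamilyRing U)) :
    F.kernel M ↔ ∀ i m, (annihilator M i m).Covers := by
  refine ⟨fun hM i m Y g hg => ?_, fun h => ?_⟩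
  · have := homFunctor_faithful hU
    refine (homFunctor U).map_injective ?_
    rw [Functor.map_zero]
    -- The coordinates of an element in the kernel of `ofElement M i m` annihilate m · 𝟙 (U i), so
    -- `g` kills them and G(g) vanishes on this kernel.
    refine eq_zero_of_kernel_ι_comp_eq_zero adj hU hM (ofElement M i m) _ (coord_ext fun k y => ?_)
    rw [coord_comp_map, coord_zero]
    refine hg k _ ?_
    rw [mem_annihilator]
    have h := ract_ofElement M i m (𝟙 (U k)) ((kernel.ι (ofElement M i m)).hom y)
    rw [Category.id_comp] at h
    refine h.symm.trans ?_
    have h' : (ofElement M i m).hom ((kernel.ι (ofElement M i m)).hom y) = 0 :=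
      congrArg (fun e : kernel (ofElement M i m) ⟶ M => e.hom y) (kernel.condition _)
    rw [h', map_zero]
  -- Each coordinate at `m` of the unit is killed by the annihilator of m · 𝟙 (U i), so covering
  -- annihilators force the unit to vanish.
  · refine kernel_of_unit_eq_zero adj (coord_ext fun i (m : M.obj) => ?_)
    rw [coord_zero]
    refine h i m _ fun k r hr => ?_
    exact (coord_ract (M := M) _ _ _).symm.trans (by rw [mem_annihilator.1 hr, map_zero])

/-- By fullness, the projection followed by the unit is G(g) for a morphism `g` out of `X`. This `g`
kills the covering ideal `a`, so it is zero, and so is the unit. -/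
lemma kernel_quotient {F : UnitaryMod (FamilyRing U) ⥤ C} (adj : F ⊣ homFunctor U)
    (hU : (ObjectProperty.ofObj U).IsSeparating) {X : C} {a : RightIdeal U X}
    (ha : a.Covers) : F.kernel a.quotient := by
  have := homFunctor_full hU
  refine kernel_of_unit_eq_zero adj ?_
  rw [← cancel_epi a.proj, comp_zero]
  obtain ⟨g, hg⟩ := (homFunctor U).map_surjective (a.proj ≫ adj.unit.app a.quotient)
  rw [← hg, ha g, Functor.map_zero]
  intro k r hr
  have h : coord (𝟙 _ ≫ (homFunctor U).map g) k (elt k r) = r ≫ g := by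
    rw [coord_comp_map, coord_id_elt]
  rw [← h, Category.id_comp, hg]
  refine (coord_comp _ _ _ _).trans ?_
  rw [(a.proj_elt_eq_zero_iff r).2 hr, map_zero]

/-- In the product of the quotients by the `a j`, the element with components the classes of 𝟙 (U i)
has annihilator contained in the intersection of the `a j`. -/
theorem coversInter_of_isClosedUnderProducts
    {F : UnitaryMod (FamilyRing U) ⥤ C} (adj : F ⊣ homFunctor U)
    (hU : (ObjectProperty.ofObj U).IsSeparating)
    (h : IsClosedUnderProducts F.kernel) : CoversInter U := by
  intro i J a ha
  have := h J
  have hP : F.kernel (∏ᶜ fun j => (a j).quotient) :=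
    ObjectProperty.prop_pi _ _ fun j => kernel_quotient adj hU (ha j)
  let q := Pi.lift fun j => (a j).proj
  refine ((kernel_iff adj hU _).1 hP i (q.hom (elt i (𝟙 _)))).mono fun k r hr => ?_
  rw [mem_annihilator, ← map_ract, ract_elt, Category.comp_id] at hr
  refine RightIdeal.mem_inter.2 fun j => ?_
  rw [← RightIdeal.proj_elt_eq_zero_iff, ← Pi.lift_π (fun j => (a j).proj) j]
  exact (congrArg (Pi.π (fun j => (a j).quotient) j).hom hr).trans (map_zero _)

/-- The annihilator of an element of a product contains the intersection of the annihilators of its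
components. -/
theorem isClosedUnderProducts_of_coversInter
    {F : UnitaryMod (FamilyRing U) ⥤ C} (adj : F ⊣ homFunctor U)
    (hU : (ObjectProperty.ofObj U).IsSeparating)
    (h : CoversInter U) : IsClosedUnderProducts F.kernel := by
  refine fun J => ⟨?_⟩
  rintro M ⟨p⟩
  rw [kernel_iff adj hU]
  intro i m
  refine (h i J (fun j => annihilator (p.diag.obj ⟨j⟩) i ((p.π.app ⟨j⟩).hom m)) fun j =>
    (kernel_iff adj hU _).1 (p.prop_diag_obj ⟨j⟩) i _).mono fun k r hr => ?_
  rw [RightIdeal.mem_inter] at hr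
  rw [mem_annihilator]
  refine eq_zero_of_isLimit p.isLimit ?_
  rintro ⟨j⟩
  refine (map_ract _ _ _).trans ?_
  exact mem_annihilator.1 (hr j)

end Kernel

/-! ### Directed sums of subobjects and factorization -/

section Subobjects

variable {C : Type u} [Category.{v} C] [Abelian C]

lemma factors_iff_imageSubobject_le {X Y : C} (P : Subobject Y) (f : X ⟶ Y) :
    P.Factors f ↔ imageSubobject f ≤ P := by
  refine ⟨fun h => imageSubobject_le f (P.factorThru f h) (P.factorThru_arrow f h), fun h => ?_⟩
  refine Subobject.factors_of_le f h ?_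
  simpa using imageSubobject_factors_comp_self f (𝟙 X)

lemma factors_iff_comp_cokernel_π_eq_zero {X Y : C} (P : Subobject Y) (f : X ⟶ Y) :
    P.Factors f ↔ f ≫ cokernel.π P.arrow = 0 := by
  refine ⟨fun h => ?_, fun h => ?_⟩
  · rw [← P.factorThru_arrow f h, Category.assoc, cokernel.condition, comp_zero]
  · obtain ⟨l, hl⟩ := KernelFork.IsLimit.lift'
      (Abelian.monoIsKernelOfCokernel _ (cokernelIsCokernel P.arrow)) f h
    rw [← hl]
    exact Subobject.factors_comp_arrow l

lemma eq_top_of_cokernel_π_eq_zero {Y : C} (P : Subobject Y) (h : cokernel.π P.arrow = 0) :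
    P = ⊤ := by
  have := Abelian.epi_of_cokernel_π_eq_zero _ h
  rw [← Subobject.isIso_arrow_iff_eq_top]
  exact isIso_of_mono_of_epi _

variable [IsGrothendieckAbelian.{v} C]

lemma factors_iInf {X Y : C} {J : Type v} (P : J → Subobject Y) (f : X ⟶ Y)
    (h : ∀ j, (P j).Factors f) : (⨅ j, P j).Factors f := by
  simp only [factors_iff_imageSubobject_le] at h ⊢
  exact le_iInf h

attribute [local instance] IsFiltered.isConnected

/-- Detecting the vanishing of a morphism by pulling back along the inclusions of a filtered
colimit. -/
lemma eq_zero_of_pullback_isColimit {J : Type v} [SmallCategory J] [IsFiltered J] {F : J ⥤ C}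
    {c : Cocone F} (hc : IsColimit c) {X Y : C} (f : X ⟶ c.pt) (g : X ⟶ Y)
    (h : ∀ j, pullback.snd (c.ι.app j) f ≫ g = 0) : g = 0 := by
  refine (hc.pullbackOfHasExactColimitsOfShape f).hom_ext (fun j => ?_)
  rw [← cancel_epi (pullbackObjIso _ _ _).inv]
  simpa using! h j

/-- Detecting the vanishing of a morphism on the inverse images of a directed family of
subobjects. -/
lemma eq_zero_of_factors_iSup {X M Y : C} {I : Type v} [Nonempty I] {L : I → Subobject M}
    (hL : Directed (· ≤ ·) L) (f : X ⟶ M) (hf : (⨆ i, L i).Factors f) (g : X ⟶ Y)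
    (h : ∀ i ⦃Z : C⦄ (r : Z ⟶ X), (L i).Factors (r ≫ f) → r ≫ g = 0) : g = 0 := by
  -- The order pulled back along `L` makes `I` a filtered category. Its colimit is a subobject of
  -- `M`, namely the sum of the `L i`, because filtered colimits are exact.
  let _ : Preorder I := Preorder.lift L
  have : IsDirectedOrder I := ⟨hL⟩
  let D : I ⥤ MonoOver M :=
    { obj i := MonoOver.mk (L i).arrow
      map {i j} φ := MonoOver.homMk
        (Subobject.ofLE _ _ (show L i ≤ L j from (leOfHom φ : i ≤ j))) }
  let c := colimit.cocone (D ⋙ MonoOver.forget _ ⋙ Over.forget _)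
  let d : c.pt ⟶ M := colimit.desc _ (Cocone.mk M
    { app i := (L i).arrow
      naturality i j φ :=
        (Subobject.ofLE_arrow (show L i ≤ L j from (leOfHom φ : i ≤ j))).trans
          (Category.comp_id _).symm })
  have hd (i) : c.ι.app i ≫ d = (L i).arrow := colimit.ι_desc _ _
  have := IsGrothendieckAbelian.mono_of_isColimit_monoOver D (colimit.isColimit _) d hd
  have hd' : Subobject.mk d = ⨆ i, L i :=
    (IsGrothendieckAbelian.subobjectMk_of_isColimit_eq_iSup D (colimit.isColimit _) d hd).trans
      (iSup_congr fun i => Subobject.mk_arrow (L i))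
  rw [← hd'] at hf
  obtain ⟨f', hf'⟩ : ∃ f' : X ⟶ c.pt, f' ≫ d = f := (Subobject.mk_factors_iff d f).1 hf
  refine eq_zero_of_pullback_isColimit (c := c) (colimit.isColimit _) f' g fun i => h i _ ?_
  have : pullback.snd (c.ι.app i) f' ≫ f = pullback.fst (c.ι.app i) f' ≫ (L i).arrow := by
    rw [← hd, ← hf', ← Category.assoc, ← Category.assoc, pullback.condition]
  rw [this]
  exact Subobject.factors_comp_arrow _

end Subobjects

/-! ### Ab6 from intersections of covering ideals -/

section AB6

variable {C : Type u} [Category.{v} C] [Abelian C] [IsGrothendieckAbelian.{v} C] {ι : Type v}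
  {U : ι → C}

/-- The morphisms `r` such that `r ≫ f` factors through a member of a directed family of
subobjects. -/
def factorsIdeal (U : ι → C) {X M : C} (f : X ⟶ M) {I : Type v} [Nonempty I]
    {L : I → Subobject M} (hL : Directed (· ≤ ·) L) : RightIdeal U X where
  carrier k :=
    { carrier := {r | ∃ i, (L i).Factors (r ≫ f)}
      zero_mem' := ⟨Classical.arbitrary I, by rw [zero_comp]; exact Subobject.factors_zero⟩
      add_mem' := by
        rintro r s ⟨i, hi⟩ ⟨j, hj⟩
        obtain ⟨l, hil, hjl⟩ := hL i j
        refine ⟨l, ?_⟩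
        rw [Preadditive.add_comp]
        exact Subobject.factors_add _ _ (Subobject.factors_of_le _ hil hi)
          (Subobject.factors_of_le _ hjl hj)
      neg_mem' := by
        rintro r ⟨i, hi⟩
        refine ⟨i, ?_⟩
        have : (-r) ≫ f = (-𝟙 _) ≫ r ≫ f := by simp
        rw [this]
        exact Subobject.factors_of_factors_right _ hi }
  comp_mem s r := by
    rintro ⟨i, hi⟩
    refine ⟨i, ?_⟩
    rw [Category.assoc]
    exact Subobject.factors_of_factors_right _ hi

lemma factorsIdeal_covers (hU : (ObjectProperty.ofObj U).IsSeparating) {X M : C} (f : X ⟶ M)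
    {I : Type v} [Nonempty I] {L : I → Subobject M} (hL : Directed (· ≤ ·) L)
    (hf : (⨆ i, L i).Factors f) : (factorsIdeal U f hL).Covers := by
  intro Y g hg
  refine eq_zero_of_factors_iSup hL f hf g fun i Z r hr => ?_
  refine (Preadditive.isSeparating_iff _).1 hU _ ?_
  rintro _ ⟨k⟩ t
  rw [← Category.assoc]
  refine hg k _ ⟨i, ?_⟩
  rw [Category.assoc]
  exact Subobject.factors_of_factors_right _ hr

/-- For a generator mapping to the left-hand side, the morphisms that land in some `L j i` form a
covering ideal for each `j`. A morphism in all of these ideals yields a choice `φ` of members, and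
lands in the corresponding term on the right. -/
theorem ab6_of_coversInter (hU : (ObjectProperty.ofObj U).IsSeparating) (h : CoversInter U) :
    AB6 C := by
  intro M J I _ L hL
  refine le_antisymm (Subobject.le_of_factors ?_) (iSup_le fun φ => le_iInf fun j =>
    (iInf_le _ j).trans (le_iSup (L j) (φ j)))
  rw [factors_iff_comp_cokernel_π_eq_zero]
  refine (Preadditive.isSeparating_iff _).1 hU _ ?_
  rintro _ ⟨k⟩ t
  rw [← Category.assoc]
  refine h k J (fun j => factorsIdeal U (t ≫ Subobject.arrow _) (hL j)) (fun j =>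
    factorsIdeal_covers hU _ (hL j) (Subobject.factors_of_le _ (iInf_le _ j)
      (Subobject.factors_comp_arrow t))) _ fun l r hr => ?_
  rw [RightIdeal.mem_inter] at hr
  choose φ hφ using hr
  rw [← Category.assoc, ← factors_iff_comp_cokernel_π_eq_zero]
  exact Subobject.factors_of_le _ (le_iSup (fun φ : ∀ j, I j => ⨅ j, L j (φ j)) φ)
    (factors_iInf _ _ hφ)

end AB6

/-! ### Ab4* and the converse implication -/

section AB4Star

variable {C : Type u} [Category.{v} C] [Abelian C] {ι : Type v} {U : ι → C}

/-- The morphisms `r` such that `r ≫ y` lifts along `p`. -/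
def liftsIdeal (U : ι → C) {X Y V : C} (p : X ⟶ Y) (y : V ⟶ Y) : RightIdeal U V where
  carrier k :=
    { carrier := {r | ∃ s, s ≫ p = r ≫ y}
      zero_mem' := ⟨0, by simp⟩
      add_mem' := by
        rintro r r' ⟨s, hs⟩ ⟨s', hs'⟩
        exact ⟨s + s', by simp [hs, hs']⟩
      neg_mem' := by
        rintro r ⟨s, hs⟩
        exact ⟨-s, by simp [hs]⟩ }
  comp_mem t r := by
    rintro ⟨s, hs⟩
    exact ⟨t ≫ s, by simp [hs]⟩

/-- The pullback of `p` along `y` is an epimorphism, and any morphism from a generator to the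
pullback gives a member of the ideal. -/
lemma liftsIdeal_covers (hU : (ObjectProperty.ofObj U).IsSeparating) {X Y V : C} (p : X ⟶ Y)
    [Epi p] (y : V ⟶ Y) : (liftsIdeal U p y).Covers := by
  intro Z g hg
  rw [← cancel_epi (pullback.snd p y), comp_zero]
  refine (Preadditive.isSeparating_iff _).1 hU _ ?_
  rintro _ ⟨k⟩ t
  rw [← Category.assoc]
  exact hg k _ ⟨t ≫ pullback.fst p y, by simp [pullback.condition]⟩

attribute [local instance] Abelian.hasFiniteBiproducts

/-- The subobject generated by finitely many morphisms of a right ideal. -/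
noncomputable def RightIdeal.span {X : C} (a : RightIdeal U X)
    (S : Finset ((k : ι) × a.carrier k)) : Subobject X :=
  imageSubobject (biproduct.desc fun x : S => (x.1.2 : U x.1.1 ⟶ X))

/-- Finiteness of `S` is essential: it makes the composite a finite sum of members of the ideal. -/
lemma RightIdeal.comp_desc_mem {X : C} (a : RightIdeal U X)
    (S : Finset ((k : ι) × a.carrier k)) {k : ι} (t : U k ⟶ ⨁ fun x : S => U x.1.1) :
    t ≫ biproduct.desc (fun x : S => (x.1.2 : U x.1.1 ⟶ X)) ∈ a.carrier k := by
  classical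
  have : biproduct.desc (fun x : S => (x.1.2 : U x.1.1 ⟶ X)) =
      ∑ x : S, biproduct.π (fun x : S => U x.1.1) x ≫ (x.1.2 : U x.1.1 ⟶ X) := by
    ext x
    simp [Preadditive.comp_sum, biproduct.ι_π_assoc, dite_comp]
  rw [this, Preadditive.comp_sum]
  refine sum_mem fun x _ => ?_
  rw [← Category.assoc]
  exact a.comp_mem _ x.1.2.2

lemma RightIdeal.span_factors {X : C} (a : RightIdeal U X)
    {S : Finset ((k : ι) × a.carrier k)} {x : (k : ι) × a.carrier k} (hx : x ∈ S) :
    (a.span S).Factors (x.2 : U x.1 ⟶ X) := by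
  rw [← biproduct.ι_desc (fun x : S => (x.1.2 : U x.1.1 ⟶ X)) ⟨x, hx⟩]
  exact imageSubobject_factors_comp_self _ _

lemma RightIdeal.span_mono {X : C} (a : RightIdeal U X) : Monotone a.span := by
  intro S T h
  refine imageSubobject_le _
    (biproduct.desc fun x : S => (a.span T).factorThru _ (a.span_factors (h x.2))) ?_
  ext x
  simp

variable [IsGrothendieckAbelian.{v} C]

/-- Only preservation of epimorphisms by products is at stake. A morphism from a generator to the
product lifts in each component along a covering ideal; along the intersection of these ideals the
componentwise lifts assemble. -/
theorem ab4Star_of_coversInter (hU : (ObjectProperty.ofObj U).IsSeparating)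
    (h : CoversInter U) : AB4Star C where
  ofShape J := by
    have : (lim : (Discrete J ⥤ C) ⥤ C).PreservesEpimorphisms := by
      refine ⟨fun {X Y} f _ => ?_⟩
      rw [Preadditive.epi_iff_cancel_zero]
      intro Z g hg
      refine (Preadditive.isSeparating_iff _).1 hU _ ?_
      rintro _ ⟨i⟩ t
      refine h i J (fun j => liftsIdeal U (f.app ⟨j⟩) (t ≫ limit.π Y ⟨j⟩))
        (fun j => liftsIdeal_covers hU _ _) _ fun k r hr => ?_
      rw [RightIdeal.mem_inter] at hr
      choose s hs using hr
      let s' : U k ⟶ lim.obj X := limit.lift X (Cone.mk _ (Discrete.natTrans fun j => s j.as))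
      have : s' ≫ lim.map f = r ≫ t := limit.hom_ext fun ⟨j⟩ => by
        simp [s', hs]
      rw [← Category.assoc, ← this, Category.assoc, hg, comp_zero]
    exact hasExactLimitsOfShape_of_preservesEpi C (Discrete J)

lemma epi_piMap [AB4Star C] {J : Type v} {X Y : J → C} (f : ∀ j, X j ⟶ Y j) [∀ j, Epi (f j)] :
    Epi (Limits.Pi.map f) := by
  have : ∀ j, Epi ((Discrete.natTrans fun j => f j.as :
      Discrete.functor X ⟶ Discrete.functor Y).app j) := fun j => inferInstanceAs (Epi (f j.as))
  have := NatTrans.epi_of_epi_app (Discrete.natTrans fun j => f j.as :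
    Discrete.functor X ⟶ Discrete.functor Y)
  exact inferInstanceAs (Epi (lim.map _))

lemma RightIdeal.Covers.iSup_span {X : C} {a : RightIdeal U X} (ha : a.Covers) :
    ⨆ S, a.span S = ⊤ := by
  refine eq_top_of_cokernel_π_eq_zero _ (ha _ fun k r hr => ?_)
  rw [← factors_iff_comp_cokernel_π_eq_zero]
  exact Subobject.factors_of_le _ (le_iSup a.span {⟨k, r, hr⟩})
    (a.span_factors (x := ⟨k, r, hr⟩) (Finset.mem_singleton_self _))

theorem coversInter_of_ab6_of_ab4Star (hU : (ObjectProperty.ofObj U).IsSeparating)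
    (h6 : AB6 C) [AB4Star C] : CoversInter U := by
  classical
  intro i J a ha Y g hg
  have hdir (j : J) : Directed (· ≤ ·) (a j).span := (a j).span_mono.directed_le
  have h := h6 (U i) J _ (fun _ => inferInstance) (fun j => (a j).span) hdir
  have h' : ⨅ j, ⨆ S, (a j).span S = ⊤ := by simp [(ha _).iSup_span]
  suffices hk : kernelSubobject g = ⊤ by
    have := (Subobject.isIso_arrow_iff_eq_top _).2 hk
    rw [← cancel_epi (kernelSubobject g).arrow, kernelSubobject_arrow_comp, comp_zero]
  -- Ab6 presents `U i` as the sum, over all choices `φ` of finite parts, of the intersections `N`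
  -- below, so `g` need only vanish on each `N`.
  rw [← top_le_iff, ← h', h]
  refine iSup_le fun φ => le_kernelSubobject _ _ ?_
  let N := ⨅ j, (a j).span (φ j)
  let d (j : J) := biproduct.desc fun x : φ j => (x.1.2 : U x.1.1 ⟶ U i)
  let e := Limits.Pi.map fun j => factorThruImageSubobject (d j)
  -- Ab4* enters here. The pullback of `e` along `q` then covers `N` by morphisms which, for every
  -- `j`, factor through the finite biproduct over `φ j` and so belong to `a j`.
  have : Epi e := epi_piMap _
  let q : (N : C) ⟶ ∏ᶜ fun j => (imageSubobject (d j) : C) :=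
    Pi.lift fun j => Subobject.ofLE _ _ (iInf_le (fun j => (a j).span (φ j)) j)
  rw [← cancel_epi (pullback.snd e q), comp_zero]
  refine (Preadditive.isSeparating_iff _).1 hU _ ?_
  rintro _ ⟨k⟩ t
  rw [← Category.assoc, ← Category.assoc]
  refine hg k _ (RightIdeal.mem_inter.2 fun j => ?_)
  have hN : N.arrow = q ≫ Pi.π _ j ≫ (imageSubobject (d j)).arrow := by
    rw [Pi.lift_π_assoc]
    exact (Subobject.ofLE_arrow _).symm
  have : (t ≫ pullback.snd e q) ≫ N.arrow = (t ≫ pullback.fst e q ≫ Pi.π _ j) ≫ d j := by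
    rw [hN, Category.assoc, ← pullback.condition_assoc]
    simp [e]
  exact this ▸ (a j).comp_desc_mem _ _

end AB4Star

/-! ### Exactness in MOD R in terms of elements -/

section Elements

variable {R : Type w} [NonUnitalRing R]

lemma cokernel_π_comp_apply {M N : UnitaryMod R} (f : M ⟶ N) (m : M.obj) :
    (cokernel.π f).hom (f.hom m) = 0 :=
  congrArg (fun g : M ⟶ cokernel f => g.hom m) (cokernel.condition f)

lemma surjective_of_epi {M N : UnitaryMod R} (f : M ⟶ N) [Epi f] :
    Function.Surjective f.hom :=
  (ModuleCat.epi_iff_surjective _).1 (inferInstanceAs (Epi ((isUnitary R).ι.map f)))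

variable [HasEnoughIdempotents R]

lemma exists_of_exact {S : ShortComplex (UnitaryMod R)} (hS : S.Exact) {m : S.X₂.obj}
    (hm : S.g.hom m = 0) : ∃ y, S.f.hom y = m := by
  have : PreservesFiniteColimits (isUnitary R).ι := ⟨fun _ _ _ => inferInstance⟩
  exact (ShortComplex.moduleCat_exact_iff _).1 (hS.map (isUnitary R).ι) m hm

lemma exists_kernel_ι_eq {M N : UnitaryMod R} (f : M ⟶ N) {m : M.obj} (hm : f.hom m = 0) :
    ∃ y, (kernel.ι f).hom y = m :=
  exists_of_exact (ShortComplex.exact_kernel f) hm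

lemma exists_eq_of_cokernel_π_eq_zero {M N : UnitaryMod R} (f : M ⟶ N) {n : N.obj}
    (hn : (cokernel.π f).hom n = 0) : ∃ m, f.hom m = n :=
  exists_of_exact (ShortComplex.exact_cokernel f) hn

end Elements

/-! ### Preservation of products by F and bilocalization -/

section Bilocalizing

variable {C : Type u} [Category.{v} C] [Abelian C] [IsGrothendieckAbelian.{v} C] {ι : Type v}
  {U : ι → C}

lemma kernel_kernel_iff {F : UnitaryMod (FamilyRing U) ⥤ C} (adj : F ⊣ homFunctor U)
    (hU : (ObjectProperty.ofObj U).IsSeparating)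
    {M N : UnitaryMod (FamilyRing U)} (f : M ⟶ N) :
    F.kernel (kernel f) ↔ ∀ m, f.hom m = 0 → ∀ i, (annihilator M i m).Covers := by
  rw [kernel_iff adj hU]
  refine ⟨fun h m hm i => ?_, fun h i y => ?_⟩
  · obtain ⟨y, rfl⟩ := exists_kernel_ι_eq f hm
    refine (h i y).mono fun k r hr => ?_
    rw [mem_annihilator, ← map_ract, mem_annihilator.1 hr, map_zero]
  · refine (h ((kernel.ι f).hom y) ?_ i).mono fun k r hr => ?_
    · exact congrArg (fun g : kernel f ⟶ N => g.hom y) (kernel.condition f)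
    · rw [mem_annihilator, ← map_ract] at hr
      exact injective_of_mono (kernel.ι f) (hr.trans (map_zero _).symm)

lemma isIso_map_iff {F : UnitaryMod (FamilyRing U) ⥤ C} (adj : F ⊣ homFunctor U)
    (hU : (ObjectProperty.ofObj U).IsSeparating)
    {M N : UnitaryMod (FamilyRing U)} (f : M ⟶ N) :
    IsIso (F.map f) ↔ F.kernel (kernel f) ∧ F.kernel (cokernel f) := by
  have := preservesFiniteLimits_leftAdjoint adj hU
  have := preservesFiniteColimits_leftAdjoint adj
  have h := Abelian.isoModSerre_kernel_eq_inverseImage_isomorphisms F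
  exact (MorphismProperty.ext_iff.1 h f).symm

lemma isIso_map_unit {F : UnitaryMod (FamilyRing U) ⥤ C} (adj : F ⊣ homFunctor U)
    (hU : (ObjectProperty.ofObj U).IsSeparating)
    (M : UnitaryMod (FamilyRing U)) : IsIso (F.map (adj.unit.app M)) := by
  have := homFunctor_full hU
  have := homFunctor_faithful hU
  infer_instance

/-- If intersections of covering right ideals are covering, then a product of morphisms which are
inverted by `F` is inverted by `F`. -/
lemma isIso_map_of_isLimit {F : UnitaryMod (FamilyRing U) ⥤ C} (adj : F ⊣ homFunctor U)
    (hU : (ObjectProperty.ofObj U).IsSeparating) (h : CoversInter U)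
    {J : Type v} {K : Discrete J ⥤ UnitaryMod (FamilyRing U)} {c : Cone K} (hc : IsLimit c)
    {K' : Discrete J ⥤ UnitaryMod (FamilyRing U)} {c' : Cone K'} (hc' : IsLimit c')
    (α : K ⟶ K') (hα : ∀ j, IsIso (F.map (α.app j))) (f : c.pt ⟶ c'.pt)
    (hf : ∀ j, f ≫ c'.π.app j = c.π.app j ≫ α.app j) : IsIso (F.map f) := by
  have hf' (j) (m : c.pt.obj) : (c'.π.app j).hom (f.hom m) = (α.app j).hom ((c.π.app j).hom m) :=
    congrArg (fun g : c.pt ⟶ K'.obj j => g.hom m) (hf j)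
  simp only [isIso_map_iff adj hU] at hα ⊢
  refine ⟨(kernel_kernel_iff adj hU f).2 fun m hm i => ?_, (kernel_iff adj hU _).2 fun i n => ?_⟩
  · refine (h i J (fun j => annihilator (K.obj ⟨j⟩) i ((c.π.app ⟨j⟩).hom m)) fun j =>
      (kernel_kernel_iff adj hU _).1 (hα ⟨j⟩).1 _ ?_ i).mono fun k r hr => ?_
    · exact (hf' _ m).symm.trans (by rw [hm, map_zero])
    · rw [mem_annihilator]
      refine eq_zero_of_isLimit hc fun ⟨j⟩ => ?_
      exact (map_ract _ _ _).trans (mem_annihilator.1 (RightIdeal.mem_inter.1 hr j))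
  -- For `r` in the intersection of the annihilators of the classes of the components of `y`, each
  -- component of y · r lies in the image of `α`; the preimages must be assembled into one element.
  · obtain ⟨y, rfl⟩ := surjective_of_epi (cokernel.π f) n
    refine (h i J (fun j => annihilator (cokernel (α.app ⟨j⟩)) i
      ((cokernel.π (α.app ⟨j⟩)).hom ((c'.π.app ⟨j⟩).hom y))) fun j =>
      (kernel_iff adj hU _).1 (hα ⟨j⟩).2 _ _).mono fun k r hr => ?_
    have hr' (j : J) : ∃ m, (α.app ⟨j⟩).hom m =
        (c'.π.app ⟨j⟩).hom (ract c'.pt.obj (FamilyRing.of U k i r) y) := by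
      refine exists_eq_of_cokernel_π_eq_zero _ ?_
      have := mem_annihilator.1 (RightIdeal.mem_inter.1 hr j)
      rw [← map_ract] at this
      rw [← this]
      exact congrArg _ (map_ract (c'.π.app ⟨j⟩).hom _ _)
    choose m hm using hr'
    -- The `m j` need not be the components of one element of the limit in MOD R. The morphisms from
    -- G(U k) that they define do assemble, and give an element with components m j · 𝟙 (U k), which
    -- suffices because r ∘ 𝟙 (U k) = r.
    let s : Cone K := Cone.mk ((homFunctor U).obj (U k))
      (Discrete.natTrans fun j => ofElement (K.obj j) k (m j.as))
    let l : (homFunctor U).obj (U k) ⟶ c.pt := hc.lift s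
    have hl (j : J) : (c.π.app ⟨j⟩).hom (l.hom (elt k (𝟙 _))) =
        ract (K.obj ⟨j⟩).obj (FamilyRing.of U k k (𝟙 _)) (m j) := by
      rw [← ofElement_elt]
      exact congrArg (fun g : (homFunctor U).obj (U k) ⟶ K.obj ⟨j⟩ => g.hom (elt k (𝟙 _)))
        (hc.fac s ⟨j⟩)
    have key : f.hom (l.hom (elt k (𝟙 _))) - ract c'.pt.obj (FamilyRing.of U k i r) y = 0 := by
      refine eq_zero_of_isLimit hc' fun ⟨j⟩ => ?_
      refine (map_sub (c'.π.app ⟨j⟩).hom.hom _ _).trans (sub_eq_zero.2 ?_)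
      refine (hf' _ _).trans ?_
      rw [hl, map_ract, hm]
      refine (map_ract (c'.π.app ⟨j⟩).hom _ _).symm.trans (congrArg (c'.π.app ⟨j⟩).hom ?_)
      refine (ract_mul c'.pt.obj _ _ y).symm.trans ?_
      rw [FamilyRing.of_mul_of, Category.id_comp]
    rw [mem_annihilator, ← map_ract, ← sub_eq_zero.1 key, cokernel_π_comp_apply]

/-- The adjunct of the comparison morphism `l` is a product of units. F inverts each unit, hence
also the product, and `l` is the image of the adjunct under F followed by the counit, an
isomorphism. -/
lemma preservesProducts {F : UnitaryMod (FamilyRing U) ⥤ C} (adj : F ⊣ homFunctor U)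
    (hU : (ObjectProperty.ofObj U).IsSeparating) (h : CoversInter U)
    (J : Type v) : PreservesLimitsOfShape (Discrete J) F where
  preservesLimit {K} :=
    { preserves {c} hc := by
        have := homFunctor_full hU
        have := homFunctor_faithful hU
        let l := limit.lift (K ⋙ F) (F.mapCone c)
        have h₁ : IsIso (F.map (adj.homEquiv _ _ l)) := by
          refine isIso_map_of_isLimit adj hU h hc
            (isLimitOfPreserves (homFunctor U) (limit.isLimit (K ⋙ F)))
            (Functor.whiskerLeft K adj.unit) (fun j => isIso_map_unit adj hU (K.obj j)) _
            fun j => ?_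
          refine (adj.homEquiv_naturality_right _ _).symm.trans ?_
          rw [show l ≫ (limit.cone (K ⋙ F)).π.app j = F.map (c.π.app j) from limit.lift_π _ _,
            adj.homEquiv_unit]
          exact (adj.unit.naturality (c.π.app j)).symm
        have h₂ : F.map (adj.homEquiv _ _ l) ≫ adj.counit.app _ = l :=
          (adj.homEquiv_counit _ _ _).symm.trans (Equiv.symm_apply_apply _ _)
        have : IsIso ((limit.isLimit (K ⋙ F)).lift (F.mapCone c)) := by
          change IsIso l
          rw [← h₂]
          infer_instance
        exact ⟨IsLimit.ofPointIso (limit.isLimit (K ⋙ F))⟩ }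

/-- F preserves products and finite limits, hence all limits, so the special adjoint functor theorem
makes it a right adjoint; the equivalence with the quotient category transfers both adjoints. -/
theorem isBilocalizing_of_coversInter {F : UnitaryMod (FamilyRing U) ⥤ C} (adj : F ⊣ homFunctor U)
    (hU : (ObjectProperty.ofObj U).IsSeparating)
    (h : CoversInter U) : IsBilocalizing F.kernel := by
  have := preservesFiniteLimits_leftAdjoint adj hU
  have := preservesProducts adj hU h
  have : PreservesLimits F := preservesLimits_of_preservesEqualizers_and_products F
  have : F.IsRightAdjoint :=
    isRightAdjoint_of_preservesLimits_of_isCoseparating.{v} (isCoseparator_coseparator _) _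
  have := adj.isLeftAdjoint
  obtain ⟨hS, e, ⟨i⟩⟩ := exists_iso_comp_equivalence adj hU
  exact ⟨hS, Functor.isLeftAdjoint_of_iso i, Functor.isRightAdjoint_of_iso i⟩

end Bilocalizing

/-- As a right adjoint, the quotient functor preserves products, and a product of zero objects is
zero. -/
lemma isClosedUnderProducts_of_isBilocalizing {A : Type u} [Category.{v} A] [Abelian A]
    {P : ObjectProperty A} (h : IsBilocalizing P) : IsClosedUnderProducts P := by
  obtain ⟨_, _, _⟩ := h
  refine fun J => ⟨?_⟩
  rintro M ⟨p⟩
  rw [← ObjectProperty.SerreClassLocalization.isZero_obj_iff P.isoModSerre.Q P]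
  have hM := isLimitOfPreserves P.isoModSerre.Q p.isLimit
  refine (IsZero.iff_id_eq_zero _).2 (hM.hom_ext fun j => IsZero.eq_of_tgt ?_ _ _)
  exact (ObjectProperty.SerreClassLocalization.isZero_obj_iff P.isoModSerre.Q P _).2
    (p.prop_diag_obj j)

end Roos

theorem theorem2p18 {C : Type u} [Category.{v} C] [Abelian C] [IsGrothendieckAbelian.{v} C]
    {ι : Type v} (U : ι → C) (hU : (ObjectProperty.ofObj U).IsSeparating) :
    (Roos.homFunctor U).IsRightAdjoint ∧
      ∀ (F : Roos.UnitaryMod (Roos.FamilyRing U) ⥤ C) (_ : F ⊣ Roos.homFunctor U),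
        Roos.IsLocalizing F.kernel ∧
        List.TFAE [
          Roos.AB6 C ∧ AB4Star C,
          Roos.IsClosedUnderProducts F.kernel,
          Roos.IsBilocalizing F.kernel] := by
  refine ⟨inferInstance, fun F adj => ⟨Roos.isLocalizing_kernel adj hU, ?_⟩⟩
  tfae_have 1 → 2 := fun ⟨h6, _⟩ => Roos.isClosedUnderProducts_of_coversInter adj hU
    (Roos.coversInter_of_ab6_of_ab4Star hU h6)
  tfae_have 2 → 1 := fun h =>
    have h' := Roos.coversInter_of_isClosedUnderProducts adj hU h
    ⟨Roos.ab6_of_coversInter hU h', Roos.ab4Star_of_coversInter hU h'⟩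
  tfae_have 2 → 3 := fun h => Roos.isBilocalizing_of_coversInter adj hU
    (Roos.coversInter_of_isClosedUnderProducts adj hU h)
  tfae_have 3 → 2 := Roos.isClosedUnderProducts_of_isBilocalizing
  tfae_finish
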